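/- Let $n\ge 1$ be an integer and let $N$ be an odd, square-free positive integer. Write $Sp_n(\mathbb Z)$ for the group of integral matrices $\begin{pmatrix}A&B\\C&D\end{pmatrix}$ with $n\times n$ blocks satisfying $A\,{}^tB=B\,{}^tA$, $C\,{}^tD=D\,{}^tC$, $A\,{}^tD-B\,{}^tC=I$, and let $$\Gamma_\infty=\left\{\begin{pmatrix}G&GY\\0&{}^tG^{-1}\end{pmatrix}: G\in GL_n(\mathbb Z),\ Y\in\mathbb Z^{n,n}_{\mathrm{sym}}\right\},\qquad \Gamma_0(4N)=\left\{\begin{pmatrix}A&B\\C&D\end{pmatrix}\in Sp_n(\mathbb Z): 4N\mid C\right\},$$ where $\mathbb Z^{n,n}_{\mathrm{sym}}$ is the set of integral symmetric $n\times n$ matrices. For square matrices write $A\perp A'=\mathrm{diag}(A,A')$, let $A^{\ell}$ in such sums denote $A\perp\cdots\perp A$ ($\ell$ times), and let $\langle 0\rangle^{\ell}$ be the $\ell\times\ell$ zero matrix. An admissible type for level $4N$ is a tuple $\sigma=((N_0,\dots,N_n),(d,d',\epsilon))$ where $N_0,\dots,N_n$ are positive integers with $N_0N_1\cdots N_n=N$,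 $d,d'\ge 0$ are integers with $d+d'\le n$, and $\epsilon\in\{+,-\}$, where $\epsilon=-$ is allowed only if $d'$ is even and $d'\neq 0$. A matrix $M\in\mathbb Z^{n,n}_{\mathrm{sym}}$ is of $\sigma$-type if $$M\equiv I_s\perp\langle 0\rangle^{n-s}\pmod{N_s}\qquad\text{for all } 0\le s\le n,$$ and $$M\equiv\begin{cases} I_d\perp 2I_{d'}\perp\langle 0\rangle^{n-d-d'}\pmod 4&\text{if }\epsilon=+,\\ I_d\perp 2\begin{pmatrix}0&1\\1&0\end{pmatrix}^{d'/2}\perp\langle 0\rangle^{n-d-d'}\pmod 4&\text{if }\epsilon=-.\end{cases}$$ Then for every admissible type $\sigma$ for level $4N$ there is a matrix of $\sigma$-type. Moreover, for any choice, for each admissible type $\sigma$ for level $4N$, of a matrix $M_\sigma$ of $\sigma$-type, the map $$\sigma\mapsto \Gamma_\infty\begin{pmatrix}I&0\\M_\sigma&I\end{pmatrix}\Gamma_0(4N)$$ is a bijection from the set of admissible types for level $4N$ onto the double quotient $\Gamma_\infty\backslash Sp_n(\mathbb Z)/\Gamma_0(4N)$; that is, the matrices $\begin{pmatrix}I&0\\M_\sigma&I\end{pmatrix}$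 form a complete and irredundant set of representatives of this double quotient. -/

import Mathlib

namespace SiegelCusps

open Matrix

/-- `Sp_n(ℤ)`: Mathlib's symplectic group, i.e. the integral matrices `(A B; C D)` with
`A * Bᵀ = B * Aᵀ`, `C * Dᵀ = D * Cᵀ` and `A * Dᵀ - B * Cᵀ = 1` (see `mem_sp_iff`). -/
abbrev Sp (n : ℕ) : Type := ↥(Matrix.symplecticGroup (Fin n) ℤ)

/-- Mathlib's symplectic group is the group given by the usual block relations. -/
theorem mem_sp_iff {n : ℕ} (A B C D : Matrix (Fin n) (Fin n) ℤ) :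
    fromBlocks A B C D ∈ Matrix.symplecticGroup (Fin n) ℤ ↔
      A * Bᵀ = B * Aᵀ ∧ C * Dᵀ = D * Cᵀ ∧ A * Dᵀ - B * Cᵀ = 1 := by
  rw [← SymplecticGroup.transpose_mem_iff, fromBlocks_transpose,
    SymplecticGroup.fromBlocks_mem_iff]
  simp only [transpose_transpose]

/-- The Siegel parabolic subgroup `Γ_∞` of `Sp_n(ℤ)`: all matrices `(G GY; 0 ᵗG⁻¹)` with
`G ∈ GL_n(ℤ)` and `Y` integral symmetric. -/
def gammaInf (n : ℕ) : Subgroup (Sp n) where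
  carrier := {γ | ∃ (G : GL (Fin n) ℤ) (Y : Matrix (Fin n) (Fin n) ℤ), Y.IsSymm ∧
    (γ : Matrix (Fin n ⊕ Fin n) (Fin n ⊕ Fin n) ℤ) =
      fromBlocks G.val (G.val * Y) 0 ((G⁻¹ : GL (Fin n) ℤ).val)ᵀ}
  one_mem' := ⟨1, 0, by simp [Matrix.IsSymm], by simp⟩
  mul_mem' := by
    rintro a b ⟨G, Y, hY, ha⟩ ⟨H, Z, hZ, hb⟩
    refine ⟨G * H, Z + (H⁻¹).val * Y * ((H⁻¹).val)ᵀ, ?_, ?_⟩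
    · simp only [Matrix.IsSymm] at hY hZ ⊢
      simp [transpose_mul, hY, hZ, Matrix.mul_assoc]
    · have hH : H.val * (H⁻¹).val = 1 := H.mul_inv
      have e : G.val * H.val * (Z + (H⁻¹).val * Y * ((H⁻¹).val)ᵀ) =
          G.val * (H.val * Z) + G.val * Y * ((H⁻¹).val)ᵀ := by
        calc _ = G.val * (H.val * Z) + G.val * (H.val * (H⁻¹).val) * Y * ((H⁻¹).val)ᵀ := by
              noncomm_ring
          _ = _ := by rw [hH, Matrix.mul_one]
      rw [Submonoid.coe_mul, ha, hb, fromBlocks_multiply, Units.val_mul, e, _root_.mul_inv_rev,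
        Units.val_mul, transpose_mul]
      simp
  inv_mem' := by
    rintro a ⟨G, Y, hY, ha⟩
    refine ⟨G⁻¹, -(G.val * Y * (G.val)ᵀ), ?_, ?_⟩
    · simp only [Matrix.IsSymm] at hY ⊢
      simp [transpose_mul, hY, Matrix.mul_assoc]
    · have hG : (G⁻¹).val * G.val = 1 := G.inv_mul
      have e : (G⁻¹).val * -(G.val * Y * (G.val)ᵀ) = -(Y * (G.val)ᵀ) := by
        calc _ = -((G⁻¹).val * G.val * Y * (G.val)ᵀ) := by noncomm_ring
          _ = _ := by rw [hG, Matrix.one_mul]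
      simp only [Matrix.IsSymm] at hY
      rw [SymplecticGroup.coe_inv, ha, inv_inv, e, fromBlocks_transpose, J]
      simp [fromBlocks_multiply, fromBlocks_neg, transpose_mul, hY]

/-- The congruence subgroup `Γ₀(m)` of `Sp_n(ℤ)`: the lower left block is divisible by `m`. -/
def gamma0 (n m : ℕ) : Subgroup (Sp n) where
  carrier := {γ | ∀ i j, (m : ℤ) ∣ (γ : Matrix (Fin n ⊕ Fin n) (Fin n ⊕ Fin n) ℤ).toBlocks₂₁ i j}
  one_mem' := by
    intro i j
    simp [toBlocks₂₁]
  mul_mem' := by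
    intro a b ha hb i j
    have h : ((a * b : Sp n) : Matrix (Fin n ⊕ Fin n) (Fin n ⊕ Fin n) ℤ).toBlocks₂₁ i j =
        ∑ k, a.val.toBlocks₂₁ i k * b.val.toBlocks₁₁ k j +
          ∑ k, a.val.toBlocks₂₂ i k * b.val.toBlocks₂₁ k j := by
      simp [toBlocks₂₁, toBlocks₁₁, toBlocks₂₂, Matrix.mul_apply]
    rw [h]
    exact dvd_add (Finset.dvd_sum fun k _ => (ha i k).mul_right _)
      (Finset.dvd_sum fun k _ => (hb k j).mul_left _)
  inv_mem' := by
    intro a ha i j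
    have h : ((a⁻¹ : Sp n) : Matrix (Fin n ⊕ Fin n) (Fin n ⊕ Fin n) ℤ).toBlocks₂₁ =
        -(a.val.toBlocks₂₁)ᵀ := by
      rw [SymplecticGroup.coe_inv]
      conv_lhs => rw [← fromBlocks_toBlocks a.val]
      rw [fromBlocks_transpose, J]
      simp [fromBlocks_multiply, fromBlocks_neg]
    rw [h]
    simpa using ha j i

/-- The element `(I 0; M I)` of `Sp_n(ℤ)` attached to an integral symmetric matrix `M`. -/
def lowerUnipotent {n : ℕ} (M : Matrix (Fin n) (Fin n) ℤ) (hM : M.IsSymm) : Sp n :=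
  ⟨fromBlocks 1 0 M 1, by
    rw [mem_sp_iff]
    simp [hM.eq]⟩

/-- The two possible signs `ε = +` and `ε = -`. -/
inductive Sign : Type
  | plus
  | minus

/-- Admissible types `((N₀, …, N_n), (d, d', ε))` for level `4N` (in degree `n`): a tuple of natural
numbers with `N₀ ⋯ N_n = N`, together with `d, d' ≥ 0` with `d + d' ≤ n`, and a sign `ε` which may
be `-` only if `d'` is even and nonzero. -/
@[ext]
structure AdmissibleType (n N : ℕ) where
  parts : Fin (n + 1) → ℕ
  prod_parts : ∏ s, parts s = N
  d : ℕ
  d' : ℕ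
  d_add_d'_le : d + d' ≤ n
  ε : Sign
  even_of_minus : ε = Sign.minus → Even d' ∧ d' ≠ 0

/-- The `n × n` matrix `I_s ⊥ ⟨0⟩^(n-s)`, for `s ≤ n`. -/
def idPerpZero (n s : ℕ) : Matrix (Fin n) (Fin n) ℤ :=
  diagonal fun i => if (i : ℕ) < s then 1 else 0

/-- The `n × n` matrix `I_d ⊥ 2 I_d' ⊥ ⟨0⟩^(n-d-d')`, for `d + d' ≤ n`. -/
def plusForm (n d d' : ℕ) : Matrix (Fin n) (Fin n) ℤ :=
  diagonal fun i => if (i : ℕ) < d then 1 else if (i : ℕ) < d + d' then 2 else 0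

/-- The `n × n` matrix `I_d ⊥ 2 (0 1; 1 0)^(d'/2) ⊥ ⟨0⟩^(n-d-d')`, for `d + d' ≤ n` and `d'` even.
In the middle block, which occupies the indices `d ≤ i < d + d'`, the entry `2` stands at the
positions `(d + 2k, d + 2k + 1)` and `(d + 2k + 1, d + 2k)`. -/
def minusForm (n d d' : ℕ) : Matrix (Fin n) (Fin n) ℤ :=
  Matrix.of fun i j =>
    if i = j then (if (i : ℕ) < d then 1 else 0)
    else if d ≤ (i : ℕ) ∧ (i : ℕ) < d + d' ∧ d ≤ (j : ℕ) ∧ (j : ℕ) < d + d' ∧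
        ((i : ℕ) - d) / 2 = ((j : ℕ) - d) / 2 then 2
    else 0

/-- The matrix modulo `4` prescribed by `(d, d', ε)`. -/
def formMod4 (n d d' : ℕ) : Sign → Matrix (Fin n) (Fin n) ℤ
  | Sign.plus => plusForm n d d'
  | Sign.minus => minusForm n d d'

/-- Entrywise congruence of integral matrices modulo `m`. -/
def MatModEq {n : ℕ} (m : ℕ) (M M' : Matrix (Fin n) (Fin n) ℤ) : Prop :=
  ∀ i j, M i j ≡ M' i j [ZMOD m]

/-- The integral matrix `M` is of `σ`-type: it is symmetric, `M ≡ I_s ⊥ ⟨0⟩^(n-s)` modulo `N_s` for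
`0 ≤ s ≤ n`, and modulo `4` it is the matrix prescribed by `(d, d', ε)`. -/
structure IsOfType {n N : ℕ} (σ : AdmissibleType n N) (M : Matrix (Fin n) (Fin n) ℤ) : Prop where
  isSymm : M.IsSymm
  modEq_parts : ∀ s : Fin (n + 1), MatModEq (σ.parts s) M (idPerpZero n s)
  modEq_four : MatModEq 4 M (formMod4 n σ.d σ.d' σ.ε)

end SiegelCusps

/-!
Write a symplectic matrix as `γ = (A B; C L)`. Since `γ⁻¹ γ'` lies in `Γ₀(m)` exactly when
`Aᵀ C' ≡ Cᵀ A'` modulo `m` (`inv_mul_mem_gamma0_iff`), the double coset of `γ` contains `(1 0; M 1)`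
exactly when there are `G ∈ GL_n(ℤ)` and a symmetric `Y` with `Gᵀ M G (A + Y C) ≡ C` modulo `m`
(`mk_eq_mk_lowerUnipotent_iff`). Everything is a statement about this congruence for `m = 4N`.

*Every double coset is represented.* The congruence is solved separately modulo `4` and modulo each
prime dividing `N`, with `G` a product of transvections. Such products lift to `SL_n(ℤ)` with
prescribed reductions modulo pairwise coprime moduli (`exists_simultaneous_lift`), because single
transvections do; so the local solutions can be glued. Locally, Smith normal form, in which the row
operations can be taken to be products of transvections, makes `C` diagonal. Modulo a prime, `C = D`
is then a diagonal idempotent, and `Y = D - D A`, `M = D` is a solution. Modulo `4`, one has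
`C = D + 2E` with orthogonal diagonal idempotents `D`, `E`, and the symplectic relations show that
`M = D + 2 E Lᵀ E` is a solution for an explicit `Y` (`two_nsmul_identities`). Here `E Lᵀ E` is, modulo
`2`, a nondegenerate symmetric form on the block of `E`. Over `𝔽₂` such a form is either a sum of
squares or hyperbolic (`exists_transpose_mul_mul_eq`), which produces the sign `ε`.

*The representatives are distinct.* If the matrices for `M` and `M'` share a double coset, then
`M ≡ Gᵀ M' G (1 + Y M)`, and conversely with `M` and `M'` exchanged. So `M` and `M'` have the same
rank modulo each prime divisor of `4N`, which determines the `N_s` and `d`. They have the same number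
of vectors in their images modulo `4`, namely `2 ^ d * 2 ^ (d + d')`, which determines `d'`. Finally,
the property that `v ⬝ M v` is divisible by `4` whenever `M v` is even is preserved
(`IsEvenOnKernel.of_reduce_eq`); it holds if `ε = -` and fails if `ε = +` and `d' ≠ 0`.
-/

namespace SiegelCusps

open Matrix

/-! ### Elementary matrices and simultaneous lifts -/

section Reduction

variable {l m n : Type*} {q : ℕ}

/-- The entrywise reduction modulo `q` of an integral matrix. -/
def reduce (q : ℕ) (A : Matrix m n ℤ) : Matrix m n (ZMod q) := A.map (Int.castRingHom (ZMod q))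

theorem reduce_apply (A : Matrix m n ℤ) (i : m) (j : n) : reduce q A i j = (A i j : ZMod q) := rfl

theorem reduce_mul [Fintype m] (A : Matrix l m ℤ) (B : Matrix m n ℤ) :
    reduce q (A * B) = reduce q A * reduce q B := Matrix.map_mul

theorem reduce_add (A B : Matrix m n ℤ) : reduce q (A + B) = reduce q A + reduce q B :=
  Matrix.map_add _ (map_add _) A B

theorem reduce_sub (A B : Matrix m n ℤ) : reduce q (A - B) = reduce q A - reduce q B :=
  Matrix.map_sub _ (map_sub _) A B

theorem reduce_one [DecidableEq n] : reduce q (1 : Matrix n n ℤ) = 1 :=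
  Matrix.map_one _ (map_zero _) (map_one _)

theorem reduce_transpose (A : Matrix m n ℤ) : reduce q Aᵀ = (reduce q A)ᵀ := rfl

theorem reduce_diagonal [DecidableEq n] (d : n → ℤ) :
    reduce q (diagonal d) = diagonal fun i => (d i : ZMod q) :=
  diagonal_map (map_zero _)

theorem reduce_eq_reduce_iff {A B : Matrix m n ℤ} :
    reduce q A = reduce q B ↔ ∀ i j, A i j ≡ B i j [ZMOD q] := by
  simp only [← ZMod.intCast_eq_intCast_iff, ← Matrix.ext_iff, reduce_apply]

theorem exists_reduce_eq (A : Matrix m n (ZMod q)) : ∃ B : Matrix m n ℤ, reduce q B = A := by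
  choose f hf using ZMod.intCast_surjective (n := q)
  exact ⟨A.map f, by ext i j; exact hf _⟩

end Reduction

/-- The elementary subgroup of `SL_n(R)`, generated by all transvections. -/
def elementaryGroup (n : ℕ) (R : Type*) [CommRing R] :
    Subgroup (Matrix.SpecialLinearGroup (Fin n) R) :=
  Subgroup.closure {g | ∃ (i j : Fin n) (h : i ≠ j) (c : R),
    g = Matrix.SpecialLinearGroup.transvection h c}

theorem transvection_mem_elementaryGroup {n : ℕ} {R : Type*} [CommRing R] {i j : Fin n}
    (h : i ≠ j) (c : R) : Matrix.SpecialLinearGroup.transvection h c ∈ elementaryGroup n R :=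
  Subgroup.subset_closure ⟨i, j, h, c, rfl⟩

theorem map_transvection {n : ℕ} {R S : Type*} [CommRing R] [CommRing S] (f : R →+* S)
    {i j : Fin n} (h : i ≠ j) (c : R) :
    Matrix.SpecialLinearGroup.map f (Matrix.SpecialLinearGroup.transvection h c) =
      Matrix.SpecialLinearGroup.transvection h (f c) := by
  ext a b
  simp [Matrix.SpecialLinearGroup.transvection_coe, Matrix.one_apply, Matrix.single_apply, apply_ite f]

theorem transpose_mem_elementaryGroup {n : ℕ} {R : Type*} [CommRing R]
    {U : Matrix.SpecialLinearGroup (Fin n) R} (hU : U ∈ elementaryGroup n R) :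
    U.transpose ∈ elementaryGroup n R := by
  induction hU using Subgroup.closure_induction with
  | mem x hx =>
    obtain ⟨i, j, h, c, rfl⟩ := hx
    convert transvection_mem_elementaryGroup h.symm c using 1
    ext a b
    simp [Matrix.SpecialLinearGroup.transvection_coe, Matrix.one_apply, Matrix.single_apply, eq_comm,
      and_comm]
  | one =>
    convert (elementaryGroup n R).one_mem using 1
    ext a b
    simp [Matrix.one_apply, eq_comm]
  | mul x y _ _ hx hy =>
    convert (elementaryGroup n R).mul_mem hy hx using 1
    exact Subtype.ext (transpose_mul _ _)
  | inv x _ hx =>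
    convert (elementaryGroup n R).inv_mem hx using 1
    exact Subtype.ext (adjugate_transpose _)

/-- For coprime `q` and `m`, an elementary matrix modulo `q` lifts to `SL_n(ℤ)` with trivial
reduction modulo `m`: each transvection does, by the Chinese remainder theorem for its entry. -/
theorem exists_lift_of_coprime {n q m : ℕ} (hqm : q.Coprime m)
    {U : Matrix.SpecialLinearGroup (Fin n) (ZMod q)} (hU : U ∈ elementaryGroup n (ZMod q)) :
    ∃ G : Matrix.SpecialLinearGroup (Fin n) ℤ,
      Matrix.SpecialLinearGroup.map (Int.castRingHom (ZMod q)) G = U ∧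
      Matrix.SpecialLinearGroup.map (Int.castRingHom (ZMod m)) G = 1 := by
  induction hU using Subgroup.closure_induction with
  | mem x hx =>
    obtain ⟨i, j, h, c, rfl⟩ := hx
    obtain ⟨a, rfl⟩ := ZMod.intCast_surjective c
    obtain ⟨u, v, huv⟩ := Nat.isCoprime_iff_coprime.2 hqm
    refine ⟨Matrix.SpecialLinearGroup.transvection h (a * (v * m)), ?_, ?_⟩
    · rw [map_transvection]
      congr 1
      have : v * (m : ℤ) = 1 - u * q := by linear_combination huv
      simp [this]
    · rw [map_transvection]
      simp [Matrix.SpecialLinearGroup.transvection_coeff_zero]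
  | one => exact ⟨1, map_one _, map_one _⟩
  | mul x y _ _ hx hy =>
    obtain ⟨G, hG, hG'⟩ := hx
    obtain ⟨H, hH, hH'⟩ := hy
    exact ⟨G * H, by rw [map_mul, hG, hH], by rw [map_mul, hG', hH', one_mul]⟩
  | inv x _ hx =>
    obtain ⟨G, hG, hG'⟩ := hx
    exact ⟨G⁻¹, by rw [map_inv, hG], by rw [map_inv, hG', inv_one]⟩

/-- Elementary matrices modulo pairwise coprime moduli have a common lift to `SL_n(ℤ)`. -/
theorem exists_simultaneous_lift {n : ℕ} (Q : Finset ℕ)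
    (hQ : (Q : Set ℕ).Pairwise Nat.Coprime)
    (U : ∀ q : ℕ, Matrix.SpecialLinearGroup (Fin n) (ZMod q))
    (hU : ∀ q ∈ Q, U q ∈ elementaryGroup n (ZMod q)) :
    ∃ G : Matrix.SpecialLinearGroup (Fin n) ℤ,
      ∀ q ∈ Q, Matrix.SpecialLinearGroup.map (Int.castRingHom (ZMod q)) G = U q := by
  have key (q : ℕ) (hq : q ∈ Q) : ∃ G : Matrix.SpecialLinearGroup (Fin n) ℤ,
      Matrix.SpecialLinearGroup.map (Int.castRingHom (ZMod q)) G = U q ∧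
      ∀ r ∈ Q, r ≠ q → Matrix.SpecialLinearGroup.map (Int.castRingHom (ZMod r)) G = 1 := by
    have hc : q.Coprime (∏ r ∈ Q.erase q, r) :=
      Nat.Coprime.prod_right fun r hr =>
        hQ hq (Finset.mem_of_mem_erase hr) (Finset.ne_of_mem_erase hr).symm
    obtain ⟨G, hG, hG'⟩ := exists_lift_of_coprime hc (hU q hq)
    refine ⟨G, hG, fun r hr hrq => ?_⟩
    have hd : r ∣ ∏ r ∈ Q.erase q, r :=
      Finset.dvd_prod_of_mem (fun r => r) (Finset.mem_erase.2 ⟨hrq, hr⟩)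
    have := congrArg (Matrix.SpecialLinearGroup.map (ZMod.castHom hd (ZMod r))) hG'
    rw [map_one] at this
    rw [← this]
    ext i j
    simp
  choose! G hG hG' using key
  suffices ∀ S ⊆ Q, ∃ H : Matrix.SpecialLinearGroup (Fin n) ℤ,
      (∀ q ∈ S, Matrix.SpecialLinearGroup.map (Int.castRingHom (ZMod q)) H = U q) ∧
      ∀ q ∈ Q, q ∉ S → Matrix.SpecialLinearGroup.map (Int.castRingHom (ZMod q)) H = 1 by
    obtain ⟨H, hH, -⟩ := this Q subset_rfl
    exact ⟨H, hH⟩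
  intro S
  induction S using Finset.induction_on with
  | empty => exact fun _ => ⟨1, by simp, by simp⟩
  | insert q S hqS ih =>
    intro hS
    obtain ⟨H, hH, hH'⟩ := ih fun x hx => hS (Finset.mem_insert_of_mem hx)
    have hq : q ∈ Q := hS (Finset.mem_insert_self _ _)
    refine ⟨H * G q, fun r hr => ?_, fun r hr hrS => ?_⟩
    · rcases Finset.mem_insert.1 hr with rfl | hr'
      · rw [map_mul, hH' _ hq hqS, hG _ hq, one_mul]
      · rw [map_mul, hH _ hr', hG' _ hq _ (hS hr) (by rintro rfl; exact hqS hr'), mul_one]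
    · rw [Finset.mem_insert, not_or] at hrS
      rw [map_mul, hH' _ hr hrS.2, hG' _ hq _ hr hrS.1, one_mul]

/-- Integers that are the idempotents of the Chinese remainder theorem. -/
theorem exists_crt_idempotents {ι : Type*} [DecidableEq ι] (Q : Finset ι) (m : ι → ℕ)
    (hQ : (Q : Set ι).Pairwise fun i j => (m i).Coprime (m j)) :
    ∃ e : ι → ℤ, ∀ i ∈ Q, ∀ j ∈ Q, (e i : ZMod (m j)) = if i = j then 1 else 0 := by
  have key (i : ι) (hi : i ∈ Q) : ∃ e : ℤ, ∀ j ∈ Q, (e : ZMod (m j)) = if i = j then 1 else 0 := by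
    have hc : (m i).Coprime (∏ j ∈ Q.erase i, m j) :=
      Nat.Coprime.prod_right fun j hj =>
        hQ hi (Finset.mem_of_mem_erase hj) (Finset.ne_of_mem_erase hj).symm
    obtain ⟨u, v, huv⟩ := Nat.isCoprime_iff_coprime.2 hc
    refine ⟨v * (∏ j ∈ Q.erase i, m j : ℕ), fun j hj => ?_⟩
    split_ifs with hij
    · subst hij
      rw [eq_sub_of_add_eq' huv]
      simp
    · have hd : m j ∣ ∏ j ∈ Q.erase i, m j :=
        Finset.dvd_prod_of_mem m (Finset.mem_erase.2 ⟨Ne.symm hij, hj⟩)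
      rw [Int.cast_mul, Int.cast_natCast, (ZMod.natCast_eq_zero_iff _ _).2 hd, mul_zero]
  choose! e he using key
  exact ⟨e, he⟩

/-- Chinese remainder theorem for symmetric matrices. -/
theorem exists_isSymm_lift {n : ℕ} {ι : Type*} [DecidableEq ι] (Q : Finset ι) (m : ι → ℕ)
    (hQ : (Q : Set ι).Pairwise fun i j => (m i).Coprime (m j))
    (Y : ∀ i, Matrix (Fin n) (Fin n) (ZMod (m i))) (hY : ∀ i ∈ Q, (Y i).IsSymm) :
    ∃ Z : Matrix (Fin n) (Fin n) ℤ, Z.IsSymm ∧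
      ∀ i ∈ Q, reduce (m i) Z = Y i := by
  obtain ⟨e, he⟩ := exists_crt_idempotents Q m hQ
  choose f hf using fun i => ZMod.intCast_surjective (n := m i)
  refine ⟨Matrix.of fun a b => ∑ i ∈ Q, e i * f i (Y i a b), ?_, fun j hj => ?_⟩
  · ext a b
    simp only [transpose_apply, of_apply]
    exact Finset.sum_congr rfl fun i hi => by rw [(hY i hi).apply]
  · ext a b
    simp only [reduce_apply, of_apply, Int.cast_sum, Int.cast_mul]
    rw [Finset.sum_eq_single j]
    · rw [he j hj j hj, hf, if_pos rfl, one_mul]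
    · intro i hi hij
      rw [he i hi j hj, if_neg hij, zero_mul]
    · exact fun h => absurd hj h

/-! ### Smith normal form -/

section Smith

variable {n : ℕ} {R : Type*} [CommRing R]

/-- Two matrices are elementarily equivalent if row and column operations by transvections carry
one to the other. -/
def ElemEquiv (C C' : Matrix (Fin n) (Fin n) R) : Prop :=
  ∃ U ∈ elementaryGroup n R, ∃ V ∈ elementaryGroup n R,
    (U : Matrix (Fin n) (Fin n) R) * C * (V : Matrix (Fin n) (Fin n) R) = C'

theorem ElemEquiv.refl (C : Matrix (Fin n) (Fin n) R) : ElemEquiv C C :=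
  ⟨1, one_mem _, 1, one_mem _, by simp⟩

theorem ElemEquiv.trans {C C' C'' : Matrix (Fin n) (Fin n) R} (h : ElemEquiv C C')
    (h' : ElemEquiv C' C'') : ElemEquiv C C'' := by
  obtain ⟨U, hU, V, hV, rfl⟩ := h
  obtain ⟨U', hU', V', hV', rfl⟩ := h'
  exact ⟨U' * U, mul_mem hU' hU, V * V', mul_mem hV hV', by
    simp only [Matrix.SpecialLinearGroup.coe_mul, Matrix.mul_assoc]⟩

theorem ElemEquiv.transpose {C C' : Matrix (Fin n) (Fin n) R} (h : ElemEquiv C C') :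
    ElemEquiv Cᵀ C'ᵀ := by
  obtain ⟨U, hU, V, hV, rfl⟩ := h
  exact ⟨V.transpose, transpose_mem_elementaryGroup hV, U.transpose,
    transpose_mem_elementaryGroup hU, by
    simp only [Matrix.SpecialLinearGroup.coe_transpose, transpose_mul, Matrix.mul_assoc]⟩

/-- Adding multiples of row `s` to all other rows simultaneously is an elementary operation. -/
theorem exists_elementary_row_operation (s : Fin n) (x : Fin n → R) (hx : x s = 0) :
    ∃ U ∈ elementaryGroup n R, ∀ C : Matrix (Fin n) (Fin n) R, ∀ i j,
      ((U : Matrix (Fin n) (Fin n) R) * C) i j = C i j + x i * C s j := by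
  suffices ∀ S : Finset (Fin n), s ∉ S → ∃ U ∈ elementaryGroup n R,
      ∀ C : Matrix (Fin n) (Fin n) R, ∀ i j,
      ((U : Matrix (Fin n) (Fin n) R) * C) i j = C i j + if i ∈ S then x i * C s j else 0 by
    obtain ⟨U, hU, h⟩ := this (Finset.univ.erase s) (by simp)
    refine ⟨U, hU, fun C i j => ?_⟩
    rw [h]
    by_cases his : i = s
    · subst his
      simp [hx]
    · simp [his]
  intro S
  induction S using Finset.induction_on with
  | empty => exact fun _ => ⟨1, one_mem _, by simp⟩
  | insert r S hrS ih =>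
    intro hs
    rw [Finset.mem_insert, not_or] at hs
    obtain ⟨U, hU, h⟩ := ih hs.2
    refine ⟨Matrix.SpecialLinearGroup.transvection (Ne.symm hs.1) (x r) * U,
      mul_mem (transvection_mem_elementaryGroup _ _) hU, fun C i j => ?_⟩
    rw [Matrix.SpecialLinearGroup.coe_mul, Matrix.SpecialLinearGroup.transvection_coe, Matrix.mul_assoc]
    change (transvection r s (x r) * ((U : Matrix (Fin n) (Fin n) R) * C)) i j = _
    by_cases hir : i = r
    · subst hir
      rw [transvection_mul_apply_same, h, h]
      simp [hrS, hs.2]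
    · rw [transvection_mul_apply_of_ne _ _ _ _ hir, h]
      simp [hir]

/-- The matrix `C` is in Smith form as far as its first `k` rows and columns are concerned. -/
structure IsSmithUpTo (k : ℕ) (C : Matrix (Fin n) (Fin n) R) : Prop where
  off_diag : ∀ i j : Fin n, i ≠ j → (i : ℕ) < k ∨ (j : ℕ) < k → C i j = 0
  dvd : ∀ i a b : Fin n, (i : ℕ) < k → i ≤ a → i ≤ b → C i i ∣ C a b

theorem IsSmithUpTo.transpose {k : ℕ} {C : Matrix (Fin n) (Fin n) R} (h : IsSmithUpTo k C) :
    IsSmithUpTo k Cᵀ :=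
  ⟨fun i j hij hk => h.off_diag j i hij.symm hk.symm, fun i a b hi ha hb => h.dvd i b a hi hb ha⟩

theorem IsSmithUpTo.row_operation {k : ℕ} {C : Matrix (Fin n) (Fin n) R} (h : IsSmithUpTo k C)
    (s : Fin n) (hs : k ≤ s) (x : Fin n → R) (hxs : x s = 0) (hx : ∀ i : Fin n, (i : ℕ) < k → x i = 0) :
    ∃ C' : Matrix (Fin n) (Fin n) R, ElemEquiv C C' ∧ IsSmithUpTo k C' ∧
      ∀ i j, C' i j = C i j + x i * C s j := by
  obtain ⟨U, hU, hC⟩ := exists_elementary_row_operation s x hxs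
  refine ⟨U * C, ⟨U, hU, 1, one_mem _, by simp⟩, ⟨fun i j hij hk => ?_, fun i a b hi ha hb => ?_⟩,
    hC C⟩
  · rw [hC, h.off_diag i j hij hk]
    rcases hk with hk | hk
    · rw [hx i hk]
      simp
    · rw [h.off_diag s j (by rintro rfl; omega) (Or.inr hk)]
      simp
  · rw [hC, hC, hx i hi, zero_mul, add_zero]
    exact dvd_add (h.dvd i a b hi ha hb)
      ((h.dvd i s b hi (Fin.le_def.2 (by omega)) hb).mul_left _)

theorem IsSmithUpTo.column_operation {k : ℕ} {C : Matrix (Fin n) (Fin n) R} (h : IsSmithUpTo k C)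
    (s : Fin n) (hs : k ≤ s) (x : Fin n → R) (hxs : x s = 0) (hx : ∀ i : Fin n, (i : ℕ) < k → x i = 0) :
    ∃ C' : Matrix (Fin n) (Fin n) R, ElemEquiv C C' ∧ IsSmithUpTo k C' ∧
      ∀ i j, C' i j = C i j + x j * C i s := by
  obtain ⟨C', he, hC', h'⟩ := h.transpose.row_operation s hs x hxs hx
  exact ⟨C'ᵀ, he.transpose, hC'.transpose, fun i j => h' j i⟩

theorem exists_dvd_forall {ι : Type*} (hR : ∀ a b : R, a ∣ b ∨ b ∣ a) (f : ι → R) (s : Finset ι)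
    (hs : s.Nonempty) : ∃ i ∈ s, ∀ j ∈ s, f i ∣ f j := by
  classical
  induction hs using Finset.Nonempty.cons_induction with
  | singleton a => exact ⟨a, by simp, by simp⟩
  | cons a s ha _ ih =>
    obtain ⟨i, hi, h⟩ := ih
    rcases hR (f i) (f a) with hd | hd
    · refine ⟨i, by simp [hi], fun j hj => ?_⟩
      rcases Finset.mem_cons.1 hj with rfl | hj
      exacts [hd, h j hj]
    · refine ⟨a, by simp, fun j hj => ?_⟩
      rcases Finset.mem_cons.1 hj with rfl | hj
      exacts [dvd_rfl, hd.trans (h j hj)]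

/-- One step of the reduction to Smith form, over a ring whose divisibility relation is total: an
entry dividing all those of the remaining block is moved to the corner of that block, and its row
and column are cleared. -/
theorem IsSmithUpTo.exists_succ (hR : ∀ a b : R, a ∣ b ∨ b ∣ a) {k : ℕ} (hk : k < n)
    {C : Matrix (Fin n) (Fin n) R} (h : IsSmithUpTo k C) :
    ∃ C', ElemEquiv C C' ∧ IsSmithUpTo (k + 1) C' := by
  set K : Fin n := ⟨k, hk⟩ with hK
  obtain ⟨⟨a, b⟩, hab, hp⟩ := exists_dvd_forall hR (fun x : Fin n × Fin n => C x.1 x.2)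
    (Finset.Ici K ×ˢ Finset.Ici K) ⟨(K, K), by simp⟩
  simp only [Finset.mem_product, Finset.mem_Ici, Prod.forall, and_imp] at hab hp
  set p := C a b
  have hlt (i : Fin n) (hi : (i : ℕ) < k) : i ≠ K := by rintro rfl; exact lt_irrefl _ hi
  -- Move the pivot into row `k`.
  obtain ⟨C₁, e₁, h₁, hp₁, hb₁⟩ : ∃ C₁, ElemEquiv C C₁ ∧ IsSmithUpTo k C₁ ∧
      (∀ i j, K ≤ i → K ≤ j → p ∣ C₁ i j) ∧ C₁ K b = p := by
    by_cases haK : a = K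
    · exact ⟨C, .refl C, h, hp, by rw [← haK]⟩
    · obtain ⟨c, hc⟩ := hp K b le_rfl hab.2
      obtain ⟨C₁, e₁, h₁, f₁⟩ := h.row_operation a hab.1 (Pi.single K (1 - c))
        (Pi.single_eq_of_ne haK _) fun i hi => Pi.single_eq_of_ne (hlt i hi) _
      refine ⟨C₁, e₁, h₁, fun i j hi hj => ?_, ?_⟩
      · rw [f₁]
        exact dvd_add (hp i j hi hj) ((hp a j hab.1 hj).mul_left _)
      · rw [f₁, Pi.single_eq_same, hc]
        ring
  -- Move the pivot into column `k`.
  obtain ⟨C₂, e₂, h₂, hp₂, hb₂⟩ : ∃ C₂, ElemEquiv C₁ C₂ ∧ IsSmithUpTo k C₂ ∧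
      (∀ i j, K ≤ i → K ≤ j → p ∣ C₂ i j) ∧ C₂ K K = p := by
    by_cases hbK : b = K
    · exact ⟨C₁, .refl C₁, h₁, hp₁, by rw [← hb₁, hbK]⟩
    · obtain ⟨c, hc⟩ := hp₁ K K le_rfl le_rfl
      obtain ⟨C₂, e₂, h₂, f₂⟩ := h₁.column_operation b hab.2 (Pi.single K (1 - c))
        (Pi.single_eq_of_ne hbK _) fun i hi => Pi.single_eq_of_ne (hlt i hi) _
      refine ⟨C₂, e₂, h₂, fun i j hi hj => ?_, ?_⟩
      · rw [f₂]
        exact dvd_add (hp₁ i j hi hj) ((hp₁ i b hi hab.2).mul_left _)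
      · rw [f₂, Pi.single_eq_same, hc, hb₁]
        ring
  -- Clear column `k`.
  have hcol (i : Fin n) : ∃ c, K < i → C₂ i K = p * c := by
    by_cases hi : K < i
    · exact (hp₂ i K hi.le le_rfl).imp fun c hc _ => hc
    · exact ⟨0, fun h => absurd h hi⟩
  choose x hx using hcol
  obtain ⟨C₃, e₃, h₃, f₃⟩ := h₂.row_operation K le_rfl (fun i => if K < i then - x i else 0)
    (by simp) fun i hi => if_neg (by simp [Fin.lt_def, hK]; omega)
  -- Clear row `k`.
  have hrow (i : Fin n) : ∃ c, K < i → C₃ K i = p * c := by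
    by_cases hi : K < i
    · obtain ⟨c, hc⟩ := hp₂ K i le_rfl hi.le
      exact ⟨c, fun _ => by simp [f₃, hc]⟩
    · exact ⟨0, fun h => absurd h hi⟩
  choose y hy using hrow
  obtain ⟨C₄, e₄, h₄, f₄⟩ := h₃.column_operation K le_rfl (fun i => if K < i then - y i else 0)
    (by simp) fun i hi => if_neg (by simp [Fin.lt_def, hK]; omega)
  have hKK₃ : C₃ K K = p := by simp [f₃, hb₂]
  have hKK : C₄ K K = p := by simp [f₄, hKK₃]
  have hp₄ (i j : Fin n) (hi : K ≤ i) (hj : K ≤ j) : p ∣ C₄ i j := by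
    simp only [f₄, f₃]
    exact dvd_add (dvd_add (hp₂ i j hi hj) ((hp₂ K j le_rfl hj).mul_left _))
      ((dvd_add (hp₂ i K hi le_rfl) ((hp₂ K K le_rfl le_rfl).mul_left _)).mul_left _)
  have hcol₃ (i : Fin n) (hi : K < i) : C₃ i K = 0 := by
    rw [f₃, if_pos hi, hx i hi, hb₂]
    ring
  refine ⟨C₄, ((e₁.trans e₂).trans e₃).trans e₄, fun i j hij hk' => ?_, fun i a b hi ha hb => ?_⟩
  · by_cases hk : (i : ℕ) < k ∨ (j : ℕ) < k
    · exact h₄.off_diag i j hij hk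
    · rcases lt_or_gt_of_ne hij with hlt | hlt
      · obtain rfl : i = K := Fin.ext (by simp [hK]; rw [Fin.lt_def] at hlt; omega)
        rw [f₄, if_pos hlt, hy j hlt, hKK₃]
        ring
      · obtain rfl : j = K := Fin.ext (by simp [hK]; rw [Fin.lt_def] at hlt; omega)
        rw [f₄, hcol₃ i hlt]
        simp
  · rcases Nat.lt_succ_iff_lt_or_eq.1 hi with hi | hi
    · exact h₄.dvd i a b hi ha hb
    · obtain rfl : i = K := Fin.ext hi
      rw [hKK]
      exact hp₄ a b ha hb

/-- Smith normal form over a ring whose divisibility relation is total. -/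
theorem exists_elemEquiv_diagonal (hR : ∀ a b : R, a ∣ b ∨ b ∣ a)
    (C : Matrix (Fin n) (Fin n) R) :
    ∃ d : Fin n → R, (∀ i j, i ≤ j → d i ∣ d j) ∧ ElemEquiv C (diagonal d) := by
  have key : ∀ k ≤ n, ∃ C', ElemEquiv C C' ∧ IsSmithUpTo k C' := by
    intro k
    induction k with
    | zero => exact fun _ => ⟨C, .refl C, by simp, by simp⟩
    | succ k ih =>
      intro hk
      obtain ⟨C', e, h⟩ := ih (by omega)
      obtain ⟨C'', e', h'⟩ := h.exists_succ hR hk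
      exact ⟨C'', e.trans e', h'⟩
  obtain ⟨C', e, h⟩ := key n le_rfl
  refine ⟨fun i => C' i i, fun i j hij => h.dvd i j j i.2 hij hij, ?_⟩
  convert e
  ext i j
  by_cases hij : i = j
  · subst hij
    simp
  · rw [diagonal_apply_ne _ hij, h.off_diag i j hij (Or.inl i.2)]

/-- In Smith form, each diagonal entry may be changed by a unit. -/
theorem exists_mul_mul_eq_diagonal (hR : ∀ a b : R, a ∣ b ∨ b ∣ a) (r : R → R)
    (hr : ∀ a, ∃ u : Rˣ, a * u = r a) (C : Matrix (Fin n) (Fin n) R) :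
    ∃ d : Fin n → R, (∀ i j, i ≤ j → d i ∣ d j) ∧ ∃ U ∈ elementaryGroup n R,
      ∃ V : (Matrix (Fin n) (Fin n) R)ˣ,
        (U : Matrix (Fin n) (Fin n) R) * C * V.val = diagonal fun i => r (d i) := by
  obtain ⟨d, hd, U, hU, V, hV, h⟩ := exists_elemEquiv_diagonal hR C
  choose u hu using hr
  let D : (Matrix (Fin n) (Fin n) R)ˣ :=
    ⟨diagonal fun i => (u (d i) : R), diagonal fun i => ((u (d i))⁻¹ : Rˣ), by simp, by simp⟩
  refine ⟨d, hd, U, hU, Matrix.SpecialLinearGroup.toGL V * D, ?_⟩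
  change (U : Matrix (Fin n) (Fin n) R) * C *
    ((V : Matrix (Fin n) (Fin n) R) * diagonal fun i => (u (d i) : R)) = _
  rw [← Matrix.mul_assoc, h, diagonal_mul_diagonal]
  simp only [hu]

theorem exists_forall_lt_iff_of_antitone (P : Fin n → Prop) (hP : ∀ i j, i ≤ j → P j → P i) :
    ∃ s ≤ n, ∀ i : Fin n, P i ↔ (i : ℕ) < s := by
  classical
  by_cases h : ∃ k, ∃ hk : k < n, ¬ P ⟨k, hk⟩
  · refine ⟨Nat.find h, (Nat.find_spec h).1.le, fun i => ⟨fun hi => ?_, fun hi => ?_⟩⟩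
    · by_contra hle
      exact (Nat.find_spec h).2 (hP _ i (Fin.le_def.2 (not_lt.1 hle)) hi)
    · by_contra hi'
      exact Nat.find_min h hi ⟨i.2, hi'⟩
  · push Not at h
    exact ⟨n, le_rfl, fun i => ⟨fun _ => i.2, fun _ => h i i.2⟩⟩

end Smith

/-- Smith normal form modulo a prime. -/
theorem exists_mul_mul_eq_idPerpZero {n p : ℕ} [Fact p.Prime]
    (C : Matrix (Fin n) (Fin n) (ZMod p)) :
    ∃ s ≤ n, ∃ U ∈ elementaryGroup n (ZMod p), ∃ V : (Matrix (Fin n) (Fin n) (ZMod p))ˣ,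
      (U : Matrix (Fin n) (Fin n) (ZMod p)) * C * V.val =
        reduce p (idPerpZero n s) := by
  classical
  have hR (a b : ZMod p) : a ∣ b ∨ b ∣ a := by
    by_cases ha : a = 0
    · exact Or.inr (ha ▸ dvd_zero b)
    · exact Or.inl (Ne.isUnit ha).dvd
  obtain ⟨d, hd, U, hU, V, h⟩ := exists_mul_mul_eq_diagonal hR
    (fun a => if a = 0 then 0 else 1) (fun a => by
      by_cases ha : a = 0
      · exact ⟨1, by simp [ha]⟩
      · exact ⟨(Units.mk0 a ha)⁻¹, by simp [ha]⟩) C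
  obtain ⟨s, hs, hds⟩ := exists_forall_lt_iff_of_antitone (fun i => d i ≠ 0)
    fun i j hij hj hi => hj (by simpa [hi] using hd i j hij)
  refine ⟨s, hs, U, hU, V, h.trans ?_⟩
  rw [idPerpZero, reduce_diagonal]
  congr 1
  ext i
  have := hds i
  by_cases hi : d i = 0 <;> simp_all

/-- Smith normal form modulo `4`. -/
theorem exists_mul_mul_eq_plusForm {n : ℕ} (C : Matrix (Fin n) (Fin n) (ZMod 4)) :
    ∃ d d' : ℕ, d + d' ≤ n ∧ ∃ U ∈ elementaryGroup n (ZMod 4),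
      ∃ V : (Matrix (Fin n) (Fin n) (ZMod 4))ˣ,
        (U : Matrix (Fin n) (Fin n) (ZMod 4)) * C * V.val =
          reduce 4 (plusForm n d d') := by
  have hR : ∀ a b : ZMod 4, a ∣ b ∨ b ∣ a := by decide
  obtain ⟨d, hd, U, hU, V, h⟩ := exists_mul_mul_eq_diagonal hR
    (fun a => if a = 0 then 0 else if a = 2 then 2 else 1) (by decide) C
  obtain ⟨s, hs, hds⟩ := exists_forall_lt_iff_of_antitone (fun i => ¬ 2 ∣ d i)
    fun i j hij hj hi => hj (hi.trans (hd i j hij))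
  obtain ⟨t, ht, hdt⟩ := exists_forall_lt_iff_of_antitone (fun i => d i ≠ 0)
    fun i j hij hj hi => hj (by simpa [hi] using hd i j hij)
  have hst : s ≤ t := by
    by_contra hlt
    have h₁ := (hds ⟨t, by omega⟩).2 (by simpa using hlt)
    have h₂ := hdt ⟨t, by omega⟩
    simp only [lt_irrefl, iff_false, not_not] at h₂
    exact h₁ (h₂ ▸ dvd_zero _)
  refine ⟨s, t - s, by omega, U, hU, V, h.trans ?_⟩
  rw [plusForm, reduce_diagonal]
  congr 1
  ext i
  have h₁ := hds i
  have h₂ := hdt i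
  rw [Nat.add_sub_cancel' hst]
  have key : ∀ x : ZMod 4, (if x = 0 then (0 : ZMod 4) else if x = 2 then 2 else 1) =
      if ¬ 2 ∣ x then 1 else if x ≠ 0 then 2 else 0 := by decide
  rw [key]
  simp only [h₁, h₂]
  split_ifs <;> simp

/-! ### Symmetric bilinear forms over the field with two elements -/

section BinaryForms

open Module

/-- The hyperbolic form: an orthogonal sum of blocks `(0 1; 1 0)` if `k` is even. -/
def hyperbolicForm (k : ℕ) : Matrix (Fin k) (Fin k) ℤ :=
  Matrix.of fun i j => if i ≠ j ∧ (i : ℕ) / 2 = (j : ℕ) / 2 then 1 else 0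

theorem hyperbolicForm_mul_self {k : ℕ} (hk : Even k) :
    hyperbolicForm k * hyperbolicForm k = 1 := by
  obtain ⟨m, rfl⟩ := hk
  ext i l
  rw [mul_apply]
  -- The partner of the index `i` in its block.
  obtain ⟨j, hij, hj⟩ : ∃ j : Fin (m + m), i ≠ j ∧ (i : ℕ) / 2 = (j : ℕ) / 2 := by
    by_cases h : (i : ℕ) % 2 = 0
    · exact ⟨⟨i + 1, by omega⟩, by simp [Fin.ext_iff], by simp; omega⟩
    · exact ⟨⟨i - 1, by omega⟩, by simp [Fin.ext_iff]; omega, by simp; omega⟩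
  rw [Finset.sum_eq_single j]
  · simp only [hyperbolicForm, of_apply, one_apply]
    simp only [Ne, Fin.ext_iff] at *
    split_ifs <;> omega
  · intro b _ hb
    simp only [hyperbolicForm, of_apply]
    simp only [Ne, Fin.ext_iff] at *
    split_ifs <;> omega
  · simp

universe u

variable {V : Type u} [AddCommGroup V] [Module (ZMod 2) V] [FiniteDimensional (ZMod 2) V]

/-- The orthogonal complement of a family with invertible Gram matrix. -/
theorem exists_orthogonal_of_det_ne_zero {B : LinearMap.BilinForm (ZMod 2) V} (hs : B.IsSymm)
    (hB : B.Nondegenerate) {r : ℕ} (u : Fin r → V)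
    (hu : (Matrix.of fun i j => B (u i) (u j)).det ≠ 0) :
    ∃ W : Submodule (ZMod 2) V, (B.restrict W).Nondegenerate ∧
      finrank (ZMod 2) W + r = finrank (ZMod 2) V ∧ ∀ w, w ∈ W ↔ ∀ i, B (u i) w = 0 := by
  have hinj (c : Fin r → ZMod 2) (hc : ∀ i, B (u i) (∑ j, c j • u j) = 0) : c = 0 := by
    refine Matrix.eq_zero_of_mulVec_eq_zero hu (funext fun i => ?_)
    have := hc i
    simp only [map_sum, map_smul, smul_eq_mul] at this
    simp only [mulVec, dotProduct, of_apply, Pi.zero_apply]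
    rw [← this]
    exact Finset.sum_congr rfl fun j _ => mul_comm _ _
  have hli : LinearIndependent (ZMod 2) u := by
    rw [Fintype.linearIndependent_iff]
    intro c hc i
    rw [hinj c (fun i => by rw [hc, map_zero])]
    rfl
  have hmem (w : V) : w ∈ B.orthogonal (Submodule.span (ZMod 2) (Set.range u)) ↔
      ∀ i, B (u i) w = 0 := by
    rw [LinearMap.BilinForm.mem_orthogonal_iff]
    refine ⟨fun h i => h _ (Submodule.subset_span ⟨i, rfl⟩), fun h x hx => ?_⟩
    induction hx using Submodule.span_induction with
    | mem x hx =>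
      obtain ⟨i, rfl⟩ := hx
      exact h i
    | zero => simp
    | add x y _ _ hx hy => simp [hx, hy]
    | smul a x _ hx => simp [hx]
  refine ⟨B.orthogonal (Submodule.span (ZMod 2) (Set.range u)), ?_, ?_, hmem⟩
  · refine LinearMap.BilinForm.nondegenerate_restrict_of_disjoint_orthogonal B hs.isRefl ?_
    rw [LinearMap.BilinForm.orthogonal_orthogonal hB hs.isRefl, disjoint_comm, Submodule.disjoint_def]
    intro x hx hx'
    obtain ⟨c, rfl⟩ := (Submodule.mem_span_range_iff_exists_fun (ZMod 2)).1 hx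
    rw [hinj c ((hmem _).1 hx')]
    simp
  · have h₁ := LinearMap.BilinForm.finrank_orthogonal hB (Submodule.span (ZMod 2) (Set.range u))
    have h₂ := finrank_span_eq_card hli
    have h₃ := Submodule.finrank_le (Submodule.span (ZMod 2) (Set.range u))
    rw [Fintype.card_fin] at h₂
    omega

theorem eq_one_of_ne_zero : ∀ {a : ZMod 2}, a ≠ 0 → a = 1 := by decide

theorem isSymm_restrict {V : Type u} [AddCommGroup V] [Module (ZMod 2) V]
    {B : LinearMap.BilinForm (ZMod 2) V} (hs : B.IsSymm) (W : Submodule (ZMod 2) V) :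
    (B.restrict W).IsSymm := ⟨fun x y => hs.eq x y⟩

/-- A nonzero space with a nondegenerate form contains vectors `y`, `z` with `B y z = 1`. -/
theorem exists_apply_eq_one {B : LinearMap.BilinForm (ZMod 2) V} (hB : B.Nondegenerate)
    (h : finrank (ZMod 2) V ≠ 0) : ∃ y z, B y z = 1 := by
  have : Nontrivial V := finrank_pos_iff.1 (Nat.pos_of_ne_zero h)
  obtain ⟨y, hy⟩ := exists_ne (0 : V)
  by_contra! hyz
  refine hy (hB.1 y fun z => ?_)
  by_contra h
  exact hyz y z (eq_one_of_ne_zero h)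

/-- A nondegenerate alternating form over `𝔽₂` is hyperbolic. -/
theorem exists_hyperbolic_family (k : ℕ) : ∀ (V : Type u) [AddCommGroup V] [Module (ZMod 2) V]
    [FiniteDimensional (ZMod 2) V] (B : LinearMap.BilinForm (ZMod 2) V), B.IsSymm → B.Nondegenerate →
    (∀ x, B x x = 0) → finrank (ZMod 2) V = k →
    Even k ∧ ∃ v : Fin k → V, ∀ i j, B (v i) (v j) = (hyperbolicForm k i j : ZMod 2) := by
  induction k using Nat.strong_induction_on with
  | _ k ih =>
    intro V _ _ _ B hs hB halt hk
    rcases Nat.eq_zero_or_pos k with rfl | hpos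
    · exact ⟨Even.zero, Fin.elim0, fun i => i.elim0⟩
    · obtain ⟨x, y, hxy⟩ := exists_apply_eq_one hB (by omega)
      have hyx : B y x = 1 := by rw [← hxy]; exact hs.eq _ _
      obtain ⟨W, hW, hWk, hmem⟩ := exists_orthogonal_of_det_ne_zero hs hB ![x, y]
        (by simp [det_fin_two, halt, hxy, hyx])
      obtain ⟨l, rfl⟩ : ∃ l, k = l + 2 := ⟨finrank (ZMod 2) W, by omega⟩
      obtain ⟨hl, v, hv⟩ := ih l (by omega) W (B.restrict W) (isSymm_restrict hs W) hW
        (fun x => halt x) (by omega)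
      have hx (i) : B x (v i) = 0 := (hmem _).1 (v i).2 0
      have hy (i) : B y (v i) = 0 := (hmem _).1 (v i).2 1
      have hx' (i) : B (v i) x = 0 := by rw [← hx i]; exact hs.eq _ _
      have hy' (i) : B (v i) y = 0 := by rw [← hy i]; exact hs.eq _ _
      have hv' (i j) : B (v i) (v j) = (hyperbolicForm l i j : ZMod 2) := hv i j
      have hdiv (a : ℕ) : (a + 1 + 1) / 2 = a / 2 + 1 := by omega
      refine ⟨hl.add even_two, Fin.cons x (Fin.cons y fun i => (v i : V)), fun i j => ?_⟩
      refine Fin.cases ?_ (fun i => Fin.cases ?_ (fun i => ?_) i) i <;>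
      refine Fin.cases ?_ (fun j => Fin.cases ?_ (fun j => ?_) j) j <;>
      simp [halt, hxy, hyx, hx, hy, hx', hy', hv', hyperbolicForm, Fin.ext_iff, hdiv]

/-- A nondegenerate symmetric form over `𝔽₂` that is not alternating has an orthonormal basis. -/
theorem exists_orthonormal_family (k : ℕ) : ∀ (V : Type u) [AddCommGroup V] [Module (ZMod 2) V]
    [FiniteDimensional (ZMod 2) V] (B : LinearMap.BilinForm (ZMod 2) V), B.IsSymm → B.Nondegenerate →
    (∃ x, B x x ≠ 0) → finrank (ZMod 2) V = k →
    ∃ v : Fin k → V, ∀ i j, B (v i) (v j) = (1 : Matrix (Fin k) (Fin k) (ZMod 2)) i j := by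
  induction k with
  | zero => exact fun V _ _ _ B _ _ _ _ => ⟨Fin.elim0, fun i => i.elim0⟩
  | succ k ih =>
    intro V _ _ _ B hs hB hna hk
    have compl (x : V) (hx : B x x = 1) := exists_orthogonal_of_det_ne_zero hs hB ![x]
        (by simp [hx])
    -- A vector of square one whose orthogonal complement is zero or again not alternating.
    obtain ⟨x, hx, hW⟩ : ∃ x, B x x = 1 ∧ (k = 0 ∨ ∃ z, B x z = 0 ∧ B z z = 1) := by
      obtain ⟨x, hx⟩ := hna
      replace hx := eq_one_of_ne_zero hx
      by_cases h : k = 0 ∨ ∃ z, B x z = 0 ∧ B z z = 1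
      · exact ⟨x, hx, h⟩
      push Not at h
      obtain ⟨hk0, h⟩ := h
      obtain ⟨W, hW, hWk, hmem⟩ := compl x hx
      obtain ⟨y, z, hyz⟩ := exists_apply_eq_one hW (by omega)
      replace hyz : B y z = 1 := hyz
      have hxy : B x y = 0 := (hmem _).1 y.2 0
      have hxz : B x z = 0 := (hmem _).1 z.2 0
      have hyx : B y x = 0 := by rw [← hxy]; exact hs.eq _ _
      have hzx : B z x = 0 := by rw [← hxz]; exact hs.eq _ _
      have hyy : B y y = 0 := by
        by_contra h'
        exact h y hxy (eq_one_of_ne_zero h')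
      have hzz : B z z = 0 := by
        by_contra h'
        exact h z hxz (eq_one_of_ne_zero h')
      -- The complement of `x` is alternating, so replace `x` by `x + y`, which is orthogonal to
      -- the vector `x + z` of square one.
      refine ⟨x + y, by simp [*], Or.inr ⟨x + z, ?_, by simp [*]⟩⟩
      simp only [map_add, LinearMap.add_apply, hx, hxz, hyx, hyz]
      decide
    obtain ⟨W, hWB, hWk, hmem⟩ := compl x hx
    obtain ⟨v, hv⟩ : ∃ v : Fin k → W, ∀ i j, B (v i) (v j) =
        (1 : Matrix (Fin k) (Fin k) (ZMod 2)) i j := by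
      rcases hW with rfl | ⟨z, hxz, hzz⟩
      · exact ⟨Fin.elim0, fun i => i.elim0⟩
      · refine ih W (B.restrict W) (isSymm_restrict hs W) hWB
          ⟨⟨z, (hmem z).2 (by simpa using hxz)⟩, ?_⟩ (by omega)
        change B z z ≠ 0
        rw [hzz]
        decide
    have hxv (i) : B x (v i) = 0 := (hmem _).1 (v i).2 0
    have hvx (i) : B (v i) x = 0 := by rw [← hxv i]; exact hs.eq _ _
    refine ⟨Fin.cons x fun i => (v i : V), fun i j => ?_⟩
    refine Fin.cases ?_ (fun i => ?_) i <;> refine Fin.cases ?_ (fun j => ?_) j <;>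
      simp [hx, hxv, hvx, hv, one_apply, (Fin.succ_ne_zero _).symm]

/-- Classification of nondegenerate symmetric forms over `𝔽₂`. -/
theorem exists_transpose_mul_mul_eq {k : ℕ} (T S : Matrix (Fin k) (Fin k) (ZMod 2))
    (hT : T.IsSymm) (hTS : T * S = 1) :
    ∃ X : (Matrix (Fin k) (Fin k) (ZMod 2))ˣ, X.valᵀ * T * X.val = 1 ∨
      (Even k ∧ k ≠ 0 ∧
        X.valᵀ * T * X.val = reduce 2 (hyperbolicForm k)) := by
  have hdet : T.det ≠ 0 := by
    intro h
    have := congrArg det hTS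
    rw [det_mul, h, zero_mul, det_one] at this
    exact zero_ne_one this
  have hs : (Matrix.toBilin' T).IsSymm := ⟨fun x y => by
    simp only [Matrix.toBilin'_apply']
    rw [dotProduct_comm, dotProduct_mulVec, ← mulVec_transpose, hT.eq]⟩
  have hB : (Matrix.toBilin' T).Nondegenerate :=
    LinearMap.BilinForm.nondegenerate_toBilin'_of_det_ne_zero' T hdet
  have hfin : finrank (ZMod 2) (Fin k → ZMod 2) = k := by simp
  -- A family with involutive Gram matrix consists of the columns of an invertible matrix.
  have gram (v : Fin k → Fin k → ZMod 2) (H : Matrix (Fin k) (Fin k) (ZMod 2)) (hH : H * H = 1)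
      (hv : ∀ i j, Matrix.toBilin' T (v i) (v j) = H i j) :
      ∃ X : (Matrix (Fin k) (Fin k) (ZMod 2))ˣ, X.valᵀ * T * X.val = H := by
    have h : (Matrix.of v) * T * (Matrix.of v)ᵀ = H := by
      ext i j
      rw [← hv i j, Matrix.toBilin'_apply', Matrix.mul_assoc, mul_apply]
      simp only [dotProduct, mulVec, mul_apply, of_apply, transpose_apply]
    have h' : (H * Matrix.of v * T) * (Matrix.of v)ᵀ = 1 := by
      rw [← hH]
      nth_rw 3 [← h]
      simp only [Matrix.mul_assoc]
    exact ⟨⟨(Matrix.of v)ᵀ, H * Matrix.of v * T, mul_eq_one_comm.1 h', h'⟩, by simpa using h⟩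
  by_cases hna : ∃ x, Matrix.toBilin' T x x ≠ 0
  · obtain ⟨v, hv⟩ := exists_orthonormal_family k _ _ hs hB hna hfin
    obtain ⟨X, hX⟩ := gram v 1 (one_mul 1) hv
    exact ⟨X, Or.inl hX⟩
  · push Not at hna
    obtain ⟨hk, v, hv⟩ := exists_hyperbolic_family k _ _ hs hB hna hfin
    obtain ⟨X, hX⟩ := gram v (reduce 2 (hyperbolicForm k)) (by
      rw [← reduce_mul, hyperbolicForm_mul_self hk, reduce_one]) hv
    by_cases hk0 : k = 0
    · subst hk0
      exact ⟨X, Or.inl (Subsingleton.elim _ _)⟩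
    · exact ⟨X, Or.inr ⟨hk, hk0, hX⟩⟩

end BinaryForms

/-! ### An identity for symplectic block matrices modulo 4 -/

section Algebra

variable {R : Type*} [Ring R]

set_option linter.unusedSimpArgs false in
/-- The computation behind the reduction modulo `4`, in a ring of characteristic dividing `4` with
orthogonal idempotents `D` and `E`. The elements `A`, `B`, `D + 2E`, `L` stand for the four blocks
of a symplectic matrix, and `A'`, `B'`, `L'` for the transposes of `A`, `B`, `L`. -/
theorem two_nsmul_identities (A A' B B' D E L L' : R)
    (h4 : ∀ x : R, 4 • x = 0) (hD : D * D = D) (hE : E * E = E) (hDE : D * E = 0) (hED : E * D = 0)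
    (hs : A' * (D + 2 • E) = (D + 2 • E) * A)
    (hL : (D + 2 • E) * L' = L * (D + 2 • E))
    (h1 : A * L' - B * (D + 2 • E) = 1) (h1' : L * A' - (D + 2 • E) * B' = 1) :
    D * A' * D = D * A * D ∧ 2 • (E * L' * E) = 2 • (E * L * E) ∧
    2 • (E * L' * E * (E * A' * E)) = 2 • E ∧
    (D + 2 • (E * L' * E)) *
      (A + (D - D * A * D - D * A' * E - E * A * D) * (D + 2 • E)) = D + 2 • E := by
  have hD' (x : R) : D * (D * x) = D * x := by rw [← mul_assoc, hD]
  have hE' (x : R) : E * (E * x) = E * x := by rw [← mul_assoc, hE]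
  have hDE' (x : R) : D * (E * x) = 0 := by rw [← mul_assoc, hDE, zero_mul]
  have hED' (x : R) : E * (D * x) = 0 := by rw [← mul_assoc, hED, zero_mul]
  have h22 (x : R) : 2 • (2 • x) = 0 := by rw [smul_smul]; exact h4 x
  have g1 : D * A = D * (A' * D) + 2 • (D * (A' * E)) := by
    have := congrArg (D * ·) hs
    simp only [mul_add, add_mul, smul_mul_assoc, mul_smul_comm, hD', hDE', smul_zero,
      add_zero] at this
    exact this.symm
  have g2 : D * (A' * D) = D * (A * D) := by
    have := congrArg (· * D) g1
    simp only [add_mul, mul_assoc, smul_mul_assoc, hD, hED, mul_zero, smul_zero, add_zero] at this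
    exact this.symm
  have g3 : 2 • (E * A) = E * (A' * D) + 2 • (E * (A' * E)) := by
    have := congrArg (E * ·) hs
    simp only [mul_add, add_mul, smul_mul_assoc, mul_smul_comm, hE', hED', zero_add]
      at this
    exact this.symm
  have g4 : 2 • (E * (A * D)) = E * (A' * D) := by
    have := congrArg (· * D) g3
    simp only [add_mul, mul_assoc, smul_mul_assoc, hD, hED, mul_zero, smul_zero, add_zero] at this
    exact this
  have g5 : 2 • (E * (A * E)) = 2 • (E * (A' * E)) := by
    have := congrArg (· * E) g3
    simp only [add_mul, mul_assoc, smul_mul_assoc, hE, hDE, mul_zero, zero_add] at this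
    exact this
  have g6 : D * (L' * E) = 2 • (D * (L * E)) := by
    have := congrArg (D * · * E) hL
    simp only [mul_add, add_mul, mul_assoc, smul_mul_assoc, mul_smul_comm, hD', hDE', hDE, hE,
      smul_zero, add_zero, mul_zero, zero_add] at this
    exact this
  -- `A` and `L'` are inverse to each other in the corner of `E`, modulo `2`.
  have g8 : 2 • (A' * E) = D * (A * E) + 2 • (E * (A * E)) := by
    have := congrArg (· * E) hs
    simp only [mul_add, add_mul, mul_assoc, smul_mul_assoc, mul_smul_comm, hDE, hE, mul_zero,
      zero_add] at this
    exact this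
  have g9 : E * (L * D) = 2 • (E * (L' * D)) := by
    have := congrArg (E * · * D) hL
    simp only [mul_add, add_mul, mul_assoc, smul_mul_assoc, mul_smul_comm, hE', hED', hED, hD,
      smul_zero, add_zero, mul_zero, zero_add] at this
    exact this.symm
  have g10 : D * (A * E) = 2 • (D * (A' * E)) := by
    have := congrArg (· * E) g1
    simp only [add_mul, mul_assoc, smul_mul_assoc, hDE, hE, mul_zero, zero_add] at this
    exact this
  have g7 : 2 • (E * (A * (L' * E))) = 2 • E := by
    have := congrArg (fun x => 2 • (E * x * E)) h1
    simp only [mul_add, mul_sub, sub_mul, add_mul, mul_assoc, smul_mul_assoc, mul_smul_comm, hDE,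
      hE, mul_zero, zero_add, smul_sub, h22, sub_zero, one_mul] at this
    exact this
  have g7' : 2 • (E * (L * (A' * E))) = 2 • E := by
    have := congrArg (fun x => 2 • (E * x * E)) h1'
    simp only [mul_add, mul_sub, sub_mul, add_mul, mul_assoc, smul_mul_assoc, mul_smul_comm, hED',
      hE', hE, mul_zero, zero_add, smul_sub, h22, sub_zero, one_mul] at this
    exact this
  have c1 : 2 • (E * (A' * (E * (L' * E)))) = 2 • E := by
    have h : 2 • (E * (A * (L' * E))) = (2 • (E * A)) * (L' * E) := by
      simp only [smul_mul_assoc, mul_assoc]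
    rw [← g7, h, g3, add_mul]
    simp only [smul_mul_assoc, mul_assoc]
    have : E * (A' * (D * (L' * E))) = 0 := by
      rw [g6]
      have h : E * (A' * 2 • (D * (L * E))) = 2 • (E * (A' * D)) * (L * E) := by
        simp only [smul_mul_assoc, mul_smul_comm, mul_assoc]
      rw [h, ← g4, h22, zero_mul]
    rw [this, zero_add]
  have c1' : 2 • (E * (L * (E * (A' * E)))) = 2 • E := by
    have h : 2 • (E * (L * (E * (A * E)))) = 2 • (E * (L * (E * (A' * E)))) := by
      have := congrArg (E * L * ·) g5
      simpa only [mul_smul_comm, mul_assoc] using this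
    have h' : 2 • (E * (L * (A' * E))) = E * L * (2 • (A' * E)) := by
      simp only [mul_smul_comm, mul_assoc]
    rw [← g7', h', g8, mul_add, mul_smul_comm, mul_assoc, mul_assoc, h]
    have : E * (L * (D * (A * E))) = 0 := by
      have h : E * (L * (D * (A * E))) = (E * (L * D)) * (D * (A * E)) := by
        simp only [mul_assoc, hD']
      rw [h, g9, g10, smul_mul_assoc, mul_smul_comm, h22]
    rw [this, zero_add]
  have c3 : 2 • (E * (L' * E)) = 2 • (E * (L * E)) := by
    have h : 2 • (E * (L * (E * (A' * E)))) * (L' * E) =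
        E * (L * (2 • (E * (A' * (E * (L' * E)))))) := by
      simp only [smul_mul_assoc, mul_smul_comm, mul_assoc]
    rw [c1, c1'] at h
    simpa only [smul_mul_assoc, mul_smul_comm, hE] using h
  have c4 : 2 • (E * (L' * (E * (A' * E)))) = 2 • E := by
    have := congrArg (· * (A' * E)) c3
    simp only [smul_mul_assoc, mul_assoc] at this
    rw [this, c1']
  refine ⟨by simpa only [mul_assoc] using g2, by simpa only [mul_assoc] using c3,
    by simpa only [mul_assoc, hE'] using c4, ?_⟩
  have hY : (D - D * A * D - D * A' * E - E * A * D) * (D + 2 • E) =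
      D - D * (A * D) - E * (A * D) - 2 • (D * (A' * E)) := by
    simp only [mul_add, sub_mul, mul_assoc, mul_smul_comm, hD, hE, hDE, hED, mul_zero, smul_zero]
    abel
  have e1 : D * (A + (D - D * (A * D) - E * (A * D) - 2 • (D * (A' * E)))) = D := by
    simp only [mul_add, mul_sub, mul_smul_comm, hD', hD, hDE']
    rw [g1, g2]
    abel
  have e2 : 2 • (E * L' * E) * (A + (D - D * (A * D) - E * (A * D) - 2 • (D * (A' * E)))) =
      2 • E := by
    have h : 2 • (E * L' * E) * (A + (D - D * (A * D) - E * (A * D) - 2 • (D * (A' * E)))) =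
        E * L' * (2 • (E * A)) - E * L' * (2 • (E * (A * D))) := by
      simp only [mul_add, mul_sub, smul_mul_assoc, mul_smul_comm, mul_assoc, hED', hED, hE',
        mul_zero, smul_zero]
      abel
    rw [h, g3, g4, mul_add, add_sub_cancel_left, mul_smul_comm, mul_assoc, c4]
  rw [hY, add_mul, e1, e2]

end Algebra

/-! ### Local normal forms: odd primes -/

section LocalSolutions

variable {n : ℕ} {R : Type*} [CommRing R]

/-- The first block column `(A; C)` is carried to `(1; M)` by an elementary matrix `G`, a symmetric
translation `Y` and a change of basis on the right. The latter is eliminated from the definition: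
`(G (A + Y C); G⁻ᵀ C)` and `(1; M)` span the same Lagrangian submodule if they are orthogonal for the
symplectic form, which is the equation below. -/
def IsCarriedTo (A C M : Matrix (Fin n) (Fin n) R) : Prop :=
  ∃ G ∈ elementaryGroup n R, ∃ Y : Matrix (Fin n) (Fin n) R, Y.IsSymm ∧
    (G : Matrix (Fin n) (Fin n) R)ᵀ * M * (G : Matrix (Fin n) (Fin n) R) * (A + Y * C) = C

theorem coe_mul_coe_inv (U : Matrix.SpecialLinearGroup (Fin n) R) :
    (U : Matrix (Fin n) (Fin n) R) * ((U⁻¹ : Matrix.SpecialLinearGroup (Fin n) R) :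
      Matrix (Fin n) (Fin n) R) = 1 := by
  rw [← Matrix.SpecialLinearGroup.coe_mul, mul_inv_cancel, Matrix.SpecialLinearGroup.coe_one]

theorem coe_inv_mul_coe (U : Matrix.SpecialLinearGroup (Fin n) R) :
    ((U⁻¹ : Matrix.SpecialLinearGroup (Fin n) R) : Matrix (Fin n) (Fin n) R) *
      (U : Matrix (Fin n) (Fin n) R) = 1 := by
  rw [← Matrix.SpecialLinearGroup.coe_mul, inv_mul_cancel, Matrix.SpecialLinearGroup.coe_one]

/-- It is enough to treat the pair `(U⁻ᵀ A V; U C V)`. -/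
theorem IsCarriedTo.of_mul_mul {A C M : Matrix (Fin n) (Fin n) R}
    {U : Matrix.SpecialLinearGroup (Fin n) R} (hU : U ∈ elementaryGroup n R)
    (V : (Matrix (Fin n) (Fin n) R)ˣ)
    (h : IsCarriedTo (((U⁻¹ : Matrix.SpecialLinearGroup (Fin n) R) :
      Matrix (Fin n) (Fin n) R)ᵀ * A * V.val) ((U : Matrix (Fin n) (Fin n) R) * C * V.val) M) :
    IsCarriedTo A C M := by
  obtain ⟨G, hG, Y, hY, e⟩ := h
  have hUU := coe_mul_coe_inv U
  have hUU' := coe_inv_mul_coe U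
  set W := ((U⁻¹ : Matrix.SpecialLinearGroup (Fin n) R) : Matrix (Fin n) (Fin n) R) with hW
  refine ⟨G * U⁻¹.transpose,
    mul_mem hG (transpose_mem_elementaryGroup (inv_mem hU)), (U : Matrix (Fin n) (Fin n) R)ᵀ * Y *
      (U : Matrix (Fin n) (Fin n) R), ?_, ?_⟩
  · simp only [Matrix.IsSymm, transpose_mul, transpose_transpose, hY.eq, Matrix.mul_assoc]
  · rw [Matrix.SpecialLinearGroup.coe_mul, Matrix.SpecialLinearGroup.coe_transpose, ← hW]
    have hWU : Wᵀ * (U : Matrix (Fin n) (Fin n) R)ᵀ = 1 := by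
      rw [← transpose_mul, hUU, transpose_one]
    have e' : (G : Matrix (Fin n) (Fin n) R)ᵀ * M * (G : Matrix (Fin n) (Fin n) R) *
        (Wᵀ * A + Y * ((U : Matrix (Fin n) (Fin n) R) * C)) =
        (U : Matrix (Fin n) (Fin n) R) * C := by
      rw [← V.mul_left_inj, ← e]
      noncomm_ring
    calc _ = W * ((G : Matrix (Fin n) (Fin n) R)ᵀ * M * (G : Matrix (Fin n) (Fin n) R) *
          (Wᵀ * A + Wᵀ * (U : Matrix (Fin n) (Fin n) R)ᵀ *
            (Y * ((U : Matrix (Fin n) (Fin n) R) * C)))) := by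
          simp only [transpose_mul, transpose_transpose, Matrix.mul_assoc, Matrix.mul_add]
      _ = C := by rw [hWU, Matrix.one_mul, e', ← Matrix.mul_assoc, hUU', Matrix.one_mul]

/-- If `C = D` is a symmetric idempotent, then the translation `Y = D - D A` suffices. -/
theorem isCarriedTo_of_idempotent {A D : Matrix (Fin n) (Fin n) R} (hD : D * D = D)
    (hD' : D.IsSymm) (h : Aᵀ * D = Dᵀ * A) : IsCarriedTo A D D := by
  rw [hD'.eq] at h
  have h₁ : D * A * D = D * A := by rw [← h, Matrix.mul_assoc, hD]
  refine ⟨1, one_mem _, D - D * A, ?_, ?_⟩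
  · simp only [Matrix.IsSymm, transpose_sub, transpose_mul, hD'.eq, h]
  · simp only [Matrix.SpecialLinearGroup.coe_one, transpose_one, Matrix.mul_one, Matrix.one_mul,
      Matrix.mul_add, Matrix.sub_mul, Matrix.mul_sub, hD, h₁, ← Matrix.mul_assoc]
    abel

theorem idPerpZero_mul_self (d : ℕ) : idPerpZero n d * idPerpZero n d = idPerpZero n d := by
  rw [idPerpZero, diagonal_mul_diagonal]
  congr 1
  ext i
  split_ifs <;> rfl

theorem transpose_mul_eq_of_symplectic {A C W U : Matrix (Fin n) (Fin n) R}
    (V : Matrix (Fin n) (Fin n) R) (hW : W * U = 1) (h : Aᵀ * C = Cᵀ * A) :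
    (Wᵀ * A * V)ᵀ * (U * C * V) = (U * C * V)ᵀ * (Wᵀ * A * V) := by
  have hW' : Uᵀ * Wᵀ = 1 := by rw [← transpose_mul, hW, transpose_one]
  calc _ = Vᵀ * (Aᵀ * ((W * U) * C)) * V := by
        simp only [transpose_mul, transpose_transpose, Matrix.mul_assoc]
    _ = Vᵀ * (Cᵀ * ((Uᵀ * Wᵀ) * A)) * V := by rw [hW, hW', Matrix.one_mul, Matrix.one_mul, h]
    _ = _ := by simp only [transpose_mul, Matrix.mul_assoc]

/-- Normal form modulo a prime of the first block column of a symplectic matrix. -/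
theorem exists_isCarriedTo_idPerpZero {p : ℕ} [Fact p.Prime]
    (A C : Matrix (Fin n) (Fin n) (ZMod p)) (h : Aᵀ * C = Cᵀ * A) :
    ∃ s ≤ n, IsCarriedTo A C (reduce p (idPerpZero n s)) := by
  obtain ⟨s, hs, U, hU, V, e⟩ := exists_mul_mul_eq_idPerpZero C
  refine ⟨s, hs, .of_mul_mul hU V ?_⟩
  have h' := transpose_mul_eq_of_symplectic V.val (coe_inv_mul_coe U) h
  rw [e] at h' ⊢
  refine isCarriedTo_of_idempotent ?_ ?_ h'
  · rw [← reduce_mul, idPerpZero_mul_self]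
  · rw [Matrix.IsSymm, ← reduce_transpose, idPerpZero, diagonal_transpose]

end LocalSolutions

section ModFour

variable {n : ℕ}

/-- The inclusion of `ℤ^k` into `ℤ^n` as the coordinates `d ≤ i < d + k`. -/
def blockInclusion (n d k : ℕ) : Matrix (Fin n) (Fin k) ℤ :=
  Matrix.of fun i j => if (i : ℕ) = d + j then 1 else 0

theorem blockInclusion_mul_apply {d k : ℕ} {m : Type*} (X : Matrix (Fin k) m ℤ) (i : Fin n)
    (j : m) : (blockInclusion n d k * X) i j =
      if h : d ≤ i ∧ (i : ℕ) < d + k then X ⟨i - d, by omega⟩ j else 0 := by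
  rw [mul_apply]
  split_ifs with h
  · rw [Finset.sum_eq_single ⟨i - d, by omega⟩]
    · simp [blockInclusion, h.1]
    · intro b _ hb
      have : (i : ℕ) ≠ d + b := fun h' => hb (Fin.ext (by simp; omega))
      simp [blockInclusion, this]
    · simp
  · refine Finset.sum_eq_zero fun b _ => ?_
    have : (i : ℕ) ≠ d + b := by omega
    simp [blockInclusion, this]

theorem mul_transpose_blockInclusion_apply {d k : ℕ} {m : Type*} (X : Matrix m (Fin k) ℤ)
    (i : m) (j : Fin n) : (X * (blockInclusion n d k)ᵀ) i j =
      if h : d ≤ j ∧ (j : ℕ) < d + k then X i ⟨j - d, by omega⟩ else 0 := by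
  have := blockInclusion_mul_apply (d := d) Xᵀ j i
  rwa [← transpose_apply (_ * _), transpose_mul, transpose_transpose] at this

theorem transpose_blockInclusion_mul_self {d k : ℕ} (h : d + k ≤ n) :
    (blockInclusion n d k)ᵀ * blockInclusion n d k = 1 := by
  ext i j
  rw [mul_apply, Finset.sum_eq_single ⟨d + i, by omega⟩]
  · simp [blockInclusion, one_apply, Fin.ext_iff]
  · intro b _ hb
    have : (b : ℕ) ≠ d + i := fun h' => hb (Fin.ext h')
    simp [blockInclusion, this]
  · simp

theorem transpose_blockInclusion_mul_idPerpZero {d k : ℕ} :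
    (blockInclusion n d k)ᵀ * idPerpZero n d = 0 := by
  ext i j
  rw [idPerpZero, mul_diagonal]
  by_cases h : (j : ℕ) = d + i
  · simp [h]
  · simp [blockInclusion, h]

theorem idPerpZero_mul_blockInclusion {d k : ℕ} :
    idPerpZero n d * blockInclusion n d k = 0 := by
  have := congrArg Matrix.transpose (transpose_blockInclusion_mul_idPerpZero (n := n) (d := d)
    (k := k))
  rwa [transpose_mul, transpose_transpose, idPerpZero, diagonal_transpose, transpose_zero] at this

theorem plusForm_eq {d k : ℕ} : plusForm n d k =
    idPerpZero n d + 2 • (blockInclusion n d k * (1 : Matrix (Fin k) (Fin k) ℤ) * (blockInclusion n d k)ᵀ) := by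
  ext i j
  rw [Matrix.add_apply, Matrix.smul_apply, mul_transpose_blockInclusion_apply]
  simp only [blockInclusion_mul_apply, plusForm, idPerpZero, diagonal_apply, one_apply, Fin.ext_iff]
  split_ifs <;> first | rfl | (simp at *; try omega)

theorem minusForm_eq {d k : ℕ} : minusForm n d k = idPerpZero n d +
    2 • (blockInclusion n d k * hyperbolicForm k * (blockInclusion n d k)ᵀ) := by
  ext i j
  rw [Matrix.add_apply, Matrix.smul_apply, mul_transpose_blockInclusion_apply]
  simp only [blockInclusion_mul_apply, minusForm, idPerpZero, diagonal_apply, hyperbolicForm,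
    of_apply, Fin.ext_iff]
  split_ifs <;> first | rfl | (simp at *; try omega)

end ModFour

/-! ### Local normal forms: modulo 4 -/

section ModFour

variable {n : ℕ}

theorem reduce_nsmul {l m : Type*} {q : ℕ} (a : ℕ) (A : Matrix l m ℤ) :
    reduce q (a • A) = a • reduce q A := by
  ext i j
  simp [reduce_apply]

theorem reduce_four_two_nsmul_iff {l m : Type*} {A B : Matrix l m ℤ} :
    2 • reduce 4 A = 2 • reduce 4 B ↔ reduce 2 A = reduce 2 B := by
  rw [← reduce_nsmul, ← reduce_nsmul, reduce_eq_reduce_iff, reduce_eq_reduce_iff]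
  refine forall₂_congr fun i j => ?_
  simp only [Matrix.smul_apply, nsmul_eq_mul, Int.ModEq]
  push_cast
  omega

theorem map_mem_elementaryGroup {R S : Type*} [CommRing R] [CommRing S] (f : R →+* S)
    {U : Matrix.SpecialLinearGroup (Fin n) R} (hU : U ∈ elementaryGroup n R) :
    Matrix.SpecialLinearGroup.map f U ∈ elementaryGroup n S := by
  induction hU using Subgroup.closure_induction with
  | mem x hx =>
    obtain ⟨i, j, h, c, rfl⟩ := hx
    rw [map_transvection]
    exact transvection_mem_elementaryGroup h _
  | one => rw [map_one]; exact one_mem _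
  | mul x y _ _ hx hy => rw [map_mul]; exact mul_mem hx hy
  | inv x _ hx => rw [map_inv]; exact inv_mem hx

/-- An invertible matrix modulo `2`, placed in the block of coordinates `d ≤ i < d + k`, lifts to a
product of integral transvections supported in that block. -/
theorem exists_lift_in_block {d k : ℕ} (h : d + k ≤ n) (X : (Matrix (Fin k) (Fin k) (ZMod 2))ˣ) :
    ∃ x : Matrix (Fin k) (Fin k) ℤ, reduce 2 x = X.val ∧ ∃ g ∈ elementaryGroup n ℤ,
      (g : Matrix (Fin n) (Fin n) ℤ) =
        1 + blockInclusion n d k * (x - 1) * (blockInclusion n d k)ᵀ := by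
  let Q (X : Matrix (Fin k) (Fin k) (ZMod 2)) : Prop :=
    ∃ x : Matrix (Fin k) (Fin k) ℤ, reduce 2 x = X ∧ ∃ g ∈ elementaryGroup n ℤ,
      (g : Matrix (Fin n) (Fin n) ℤ) =
        1 + blockInclusion n d k * (x - 1) * (blockInclusion n d k)ᵀ
  have hQ1 : Q 1 := ⟨1, reduce_one, 1, one_mem _, by simp⟩
  have hQmul (X Y : Matrix (Fin k) (Fin k) (ZMod 2)) (hX : Q X) (hY : Q Y) : Q (X * Y) := by
    obtain ⟨x, rfl, g, hg, hgx⟩ := hX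
    obtain ⟨y, rfl, g', hg', hgy⟩ := hY
    refine ⟨x * y, reduce_mul x y, g * g', mul_mem hg hg', ?_⟩
    rw [Matrix.SpecialLinearGroup.coe_mul, hgx, hgy]
    have hP := transpose_blockInclusion_mul_self h
    set P := blockInclusion n d k
    calc _ = 1 + P * (x - 1) * Pᵀ + P * (y - 1) * Pᵀ +
          P * ((x - 1) * ((Pᵀ * P) * (y - 1))) * Pᵀ := by
          simp only [Matrix.mul_add, Matrix.add_mul, Matrix.mul_one, Matrix.one_mul,
            Matrix.mul_assoc]
          abel
      _ = 1 + P * ((x - 1) + (y - 1) + (x - 1) * (y - 1)) * Pᵀ := by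
          rw [hP, Matrix.one_mul, Matrix.mul_add, Matrix.mul_add, Matrix.add_mul, Matrix.add_mul]
          abel
      _ = _ := by
          congr 3
          noncomm_ring
  have hQt (t : TransvectionStruct (Fin k) (ZMod 2)) : Q t.toMatrix := by
    obtain ⟨i, j, hij, c⟩ := t
    obtain ⟨a, rfl⟩ := ZMod.intCast_surjective c
    have hij' : (⟨d + i, by omega⟩ : Fin n) ≠ ⟨d + j, by omega⟩ := fun h' =>
      hij (Fin.ext (by simpa using h'))
    refine ⟨transvection i j a, ?_, Matrix.SpecialLinearGroup.transvection hij' a,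
      transvection_mem_elementaryGroup _ _, ?_⟩
    · ext b c
      change ((transvection i j a b c : ℤ) : ZMod 2) = transvection i j (a : ZMod 2) b c
      simp only [transvection, Matrix.add_apply, Matrix.one_apply, Matrix.single_apply]
      push_cast
      rfl
    · rw [Matrix.SpecialLinearGroup.transvection_coe]
      ext b c
      simp only [transvection, add_sub_cancel_left, Matrix.add_apply,
        mul_transpose_blockInclusion_apply, blockInclusion_mul_apply, Matrix.single_apply,
        Fin.ext_iff]
      congr 1
      split_ifs <;> first | rfl | (exfalso; simp at *; omega)
  have hQlist (L : List (TransvectionStruct (Fin k) (ZMod 2))) :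
      Q (L.map TransvectionStruct.toMatrix).prod := by
    induction L with
    | nil => exact hQ1
    | cons t L ih =>
      rw [List.map_cons, List.prod_cons]
      exact hQmul _ _ (hQt t) ih
  obtain ⟨L, L', D, hX⟩ := Matrix.Pivot.exists_list_transvec_mul_diagonal_mul_list_transvec X.val
  -- All invertible diagonal matrices over `𝔽₂` are trivial.
  have hD : diagonal D = 1 := by
    have hdet : X.val.det ≠ 0 := ((isUnit_iff_isUnit_det _).1 X.isUnit).ne_zero
    rw [hX, det_mul, det_mul, TransvectionStruct.det_toMatrix_prod,
      TransvectionStruct.det_toMatrix_prod, one_mul, mul_one, det_diagonal,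
      Finset.prod_ne_zero_iff] at hdet
    rw [← diagonal_one]
    congr 1
    ext i
    exact eq_one_of_ne_zero (hdet i (Finset.mem_univ i))
  rw [hX, hD, mul_one]
  exact hQmul _ _ (hQlist L) (hQlist L')

/-- Half the middle block of `formMod4`, which is the identity or the hyperbolic form. -/
def middleForm (k : ℕ) : Sign → Matrix (Fin k) (Fin k) ℤ
  | Sign.plus => 1
  | Sign.minus => hyperbolicForm k

theorem formMod4_eq {d k : ℕ} (ε : Sign) : formMod4 n d k ε = idPerpZero n d +
    2 • (blockInclusion n d k * middleForm k ε * (blockInclusion n d k)ᵀ) := by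
  cases ε
  exacts [plusForm_eq, minusForm_eq]

/-- If `M = D + 2 P t Pᵀ` solves the equation `M (A + Y C) = C` modulo `4`, the classification of
forms over `𝔽₂` brings `t` into normal form. Lifting the base change by transvections supported in
the block keeps `D` fixed. -/
theorem isCarriedTo_formMod4_of_eq {d k : ℕ} (h : d + k ≤ n)
    {A C Y : Matrix (Fin n) (Fin n) (ZMod 4)} (hY : Y.IsSymm) {t s : Matrix (Fin k) (Fin k) ℤ}
    (ht : (reduce 2 t).IsSymm) (hts : reduce 2 t * reduce 2 s = 1)
    (hC : reduce 4 (idPerpZero n d + 2 • (blockInclusion n d k * t * (blockInclusion n d k)ᵀ)) *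
      (A + Y * C) = C) :
    ∃ ε : Sign, (ε = Sign.minus → Even k ∧ k ≠ 0) ∧
      IsCarriedTo A C (reduce 4 (formMod4 n d k ε)) := by
  obtain ⟨X, hX⟩ := exists_transpose_mul_mul_eq (reduce 2 t) (reduce 2 s) ht hts
  obtain ⟨ε, hε, hXε⟩ : ∃ ε : Sign, (ε = Sign.minus → Even k ∧ k ≠ 0) ∧
      X.valᵀ * reduce 2 t * X.val = reduce 2 (middleForm k ε) := by
    rcases hX with hX | ⟨hk, hk0, hX⟩
    · exact ⟨Sign.plus, by simp, by rw [hX, middleForm, reduce_one]⟩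
    · exact ⟨Sign.minus, fun _ => ⟨hk, hk0⟩, hX⟩
  refine ⟨ε, hε, ?_⟩
  obtain ⟨x, hx, g, hg, hgx⟩ := exists_lift_in_block h X⁻¹
  have hxt : reduce 2 t = reduce 2 (xᵀ * middleForm k ε * x) := by
    rw [reduce_mul, reduce_mul, reduce_transpose, hx, ← hXε]
    calc _ = (X.val * X⁻¹.val)ᵀ * reduce 2 t * (X.val * X⁻¹.val) := by simp
      _ = _ := by simp only [transpose_mul, Matrix.mul_assoc]
  refine ⟨Matrix.SpecialLinearGroup.map (Int.castRingHom (ZMod 4)) g,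
    map_mem_elementaryGroup _ hg, Y, hY, ?_⟩
  rw [← hC]
  congr 1
  · have hg4 : (Matrix.SpecialLinearGroup.map (Int.castRingHom (ZMod 4)) g :
        Matrix (Fin n) (Fin n) (ZMod 4)) = reduce 4 (g : Matrix (Fin n) (Fin n) ℤ) := rfl
    rw [hg4, ← reduce_transpose, ← reduce_mul, ← reduce_mul, formMod4_eq]
    have hP := transpose_blockInclusion_mul_self h
    have hDP := idPerpZero_mul_blockInclusion (n := n) (d := d) (k := k)
    set P := blockInclusion n d k
    set D := idPerpZero n d
    have e₁ : Pᵀ * (g : Matrix (Fin n) (Fin n) ℤ) = x * Pᵀ := by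
      rw [hgx, Matrix.mul_add, Matrix.mul_one, ← Matrix.mul_assoc, ← Matrix.mul_assoc, hP,
        Matrix.one_mul, Matrix.sub_mul, Matrix.one_mul, add_sub_cancel]
    have e₂ : (g : Matrix (Fin n) (Fin n) ℤ)ᵀ * P = P * xᵀ := by
      simpa [transpose_mul] using congrArg Matrix.transpose e₁
    have e₃ : D * (g : Matrix (Fin n) (Fin n) ℤ) = D := by
      rw [hgx, Matrix.mul_add, Matrix.mul_one, ← Matrix.mul_assoc, ← Matrix.mul_assoc, hDP]
      simp
    have e₄ : (g : Matrix (Fin n) (Fin n) ℤ)ᵀ * D = D := by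
      simpa [transpose_mul, D, idPerpZero] using congrArg Matrix.transpose e₃
    have e₅ : (g : Matrix (Fin n) (Fin n) ℤ)ᵀ * (D + 2 • (P * middleForm k ε * Pᵀ)) *
        (g : Matrix (Fin n) (Fin n) ℤ) = D + 2 • (P * (xᵀ * middleForm k ε * x) * Pᵀ) := by
      calc _ = (g : Matrix (Fin n) (Fin n) ℤ)ᵀ * (D * (g : Matrix (Fin n) (Fin n) ℤ)) +
          2 • (((g : Matrix (Fin n) (Fin n) ℤ)ᵀ * P) * middleForm k ε *
            (Pᵀ * (g : Matrix (Fin n) (Fin n) ℤ))) := by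
            simp only [Matrix.mul_add, Matrix.add_mul, Matrix.mul_smul, Matrix.smul_mul,
              Matrix.mul_assoc]
        _ = _ := by
            rw [e₁, e₂, e₃, e₄]
            simp only [Matrix.mul_assoc]
    rw [e₅, reduce_add, reduce_add, reduce_nsmul, reduce_nsmul]
    congr 1
    simp only [reduce_mul] at hxt
    rw [reduce_four_two_nsmul_iff]
    simp only [reduce_mul, hxt]
  · rw [hC]

/-- Normal form modulo `4` of the first block column of a symplectic matrix with blocks `A`, `B`,
`C`, `L`. -/
theorem exists_isCarriedTo_formMod4 (A B C L : Matrix (Fin n) (Fin n) (ZMod 4))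
    (hAC : Aᵀ * C = Cᵀ * A) (hCL : C * Lᵀ = L * Cᵀ) (hABCL : A * Lᵀ - B * Cᵀ = 1) :
    ∃ d d' : ℕ, ∃ ε : Sign, d + d' ≤ n ∧ (ε = Sign.minus → Even d' ∧ d' ≠ 0) ∧
      IsCarriedTo A C (reduce 4 (formMod4 n d d' ε)) := by
  obtain ⟨d, k, hdk, U, hU, V, e⟩ := exists_mul_mul_eq_plusForm C
  refine ⟨d, k, ?_⟩
  suffices ∃ ε : Sign, (ε = Sign.minus → Even k ∧ k ≠ 0) ∧
      IsCarriedTo (((U⁻¹ : Matrix.SpecialLinearGroup (Fin n) (ZMod 4)) :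
        Matrix (Fin n) (Fin n) (ZMod 4))ᵀ * A * V.val)
        ((U : Matrix (Fin n) (Fin n) (ZMod 4)) * C * V.val) (reduce 4 (formMod4 n d k ε)) by
    obtain ⟨ε, hε, h⟩ := this
    exact ⟨ε, hdk, hε, h.of_mul_mul hU V⟩
  have hs := transpose_mul_eq_of_symplectic V.val (coe_inv_mul_coe U) hAC
  have hUW := coe_mul_coe_inv U
  set W := ((U⁻¹ : Matrix.SpecialLinearGroup (Fin n) (ZMod 4)) : Matrix (Fin n) (Fin n) (ZMod 4))
  set U' := (U : Matrix (Fin n) (Fin n) (ZMod 4))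
  have hWU : Wᵀ * U'ᵀ = 1 := by rw [← transpose_mul, hUW, transpose_one]
  have hV : V.val * V⁻¹.val = 1 := V.mul_inv
  have hV' : V⁻¹.valᵀ * V.valᵀ = 1 := by rw [← transpose_mul, hV, transpose_one]
  -- The transformed lower right and upper right blocks.
  set L₁ := U' * L * V⁻¹.valᵀ with hL₁
  set B₁ := Wᵀ * B * V⁻¹.valᵀ with hB₁
  have hL : (U' * C * V.val) * L₁ᵀ = L₁ * (U' * C * V.val)ᵀ := by
    calc _ = U' * C * (V.val * V⁻¹.val) * Lᵀ * U'ᵀ := by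
          simp only [hL₁, transpose_mul, transpose_transpose, Matrix.mul_assoc]
      _ = U' * (L * Cᵀ) * U'ᵀ := by
          rw [hV, ← hCL]
          simp only [Matrix.mul_one, Matrix.mul_assoc]
      _ = U' * L * (V⁻¹.valᵀ * V.valᵀ) * Cᵀ * U'ᵀ := by
          rw [hV']
          simp only [Matrix.mul_one, Matrix.mul_assoc]
      _ = _ := by simp only [hL₁, transpose_mul, Matrix.mul_assoc]
  have h1 : (Wᵀ * A * V.val) * L₁ᵀ - B₁ * (U' * C * V.val)ᵀ = 1 := by
    calc _ = Wᵀ * (A * (V.val * V⁻¹.val) * Lᵀ - B * (V⁻¹.valᵀ * V.valᵀ) * Cᵀ) * U'ᵀ := by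
          simp only [hL₁, hB₁, transpose_mul, transpose_transpose, Matrix.mul_assoc,
            Matrix.mul_sub, Matrix.sub_mul]
      _ = 1 := by rw [hV, hV', Matrix.mul_one, Matrix.mul_one, hABCL, Matrix.mul_one, hWU]
  set A₁ := Wᵀ * A * V.val
  clear_value A₁ L₁ B₁
  rw [e] at hs hL h1 ⊢
  set D := reduce 4 (idPerpZero n d) with hD
  set P := reduce 4 (blockInclusion n d k) with hP
  have hC : reduce 4 (plusForm n d k) = D + 2 • (P * Pᵀ) := by
    rw [plusForm_eq, reduce_add, reduce_nsmul, Matrix.mul_one, reduce_mul, reduce_transpose]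
  have hDs : Dᵀ = D := by rw [hD, ← reduce_transpose, idPerpZero, diagonal_transpose]
  have hEs : (P * Pᵀ)ᵀ = P * Pᵀ := by rw [transpose_mul, transpose_transpose]
  have hCs : (D + 2 • (P * Pᵀ))ᵀ = D + 2 • (P * Pᵀ) := by
    rw [transpose_add, transpose_smul, hDs, hEs]
  rw [hC] at hs hL h1 ⊢
  rw [hCs] at hs hL h1
  have hDD : D * D = D := by
    rw [hD, ← reduce_mul, idPerpZero_mul_self]
  have hPP : Pᵀ * P = 1 := by
    rw [hP, ← reduce_transpose, ← reduce_mul, transpose_blockInclusion_mul_self hdk, reduce_one]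
  have hPD : Pᵀ * D = 0 := by
    rw [hP, hD, ← reduce_transpose, ← reduce_mul, transpose_blockInclusion_mul_idPerpZero]
    ext i j
    simp [reduce_apply]
  have hDP : D * P = 0 := by
    simpa [transpose_mul, hDs] using congrArg Matrix.transpose hPD
  have hEE : (P * Pᵀ) * (P * Pᵀ) = P * Pᵀ := by
    rw [Matrix.mul_assoc, ← Matrix.mul_assoc Pᵀ, hPP, Matrix.one_mul]
  have h4 (x : Matrix (Fin n) (Fin n) (ZMod 4)) : 4 • x = 0 := by
    ext i j
    rw [Matrix.smul_apply, nsmul_eq_mul]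
    have : ((4 : ℕ) : ZMod 4) = 0 := by decide
    rw [this, zero_mul]
    rfl
  have h1' : L₁ * A₁ᵀ - (D + 2 • (P * Pᵀ)) * B₁ᵀ = 1 := by
    have := congrArg Matrix.transpose h1
    rwa [transpose_sub, transpose_mul, transpose_mul, transpose_transpose, hCs, transpose_one]
      at this
  obtain ⟨c₁, c₂, c₃, c₄⟩ := two_nsmul_identities A₁ A₁ᵀ B₁ B₁ᵀ D (P * Pᵀ) L₁ L₁ᵀ h4 hDD hEE
    (by rw [← Matrix.mul_assoc, hDP, Matrix.zero_mul])
    (by rw [Matrix.mul_assoc, hPD, Matrix.mul_zero]) hs hL h1 h1'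
  obtain ⟨t, ht⟩ := exists_reduce_eq (Pᵀ * L₁ᵀ * P)
  obtain ⟨s, hs'⟩ := exists_reduce_eq (Pᵀ * A₁ᵀ * P)
  refine isCarriedTo_formMod4_of_eq (t := t) (s := s)
    (Y := D - D * A₁ * D - D * A₁ᵀ * (P * Pᵀ) - P * Pᵀ * A₁ * D) hdk ?_ ?_ ?_ ?_
  · simp only [Matrix.IsSymm, transpose_sub, transpose_mul, hDs, transpose_transpose]
    simp only [← Matrix.mul_assoc] at c₁ ⊢
    rw [c₁]
    abel
  · rw [Matrix.IsSymm, ← reduce_transpose, ← reduce_four_two_nsmul_iff, reduce_transpose, ht]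
    have := congrArg (Pᵀ * · * P) c₂
    simp only [Matrix.mul_smul, Matrix.smul_mul, Matrix.mul_assoc, hPP, Matrix.mul_one] at this
    simp only [← Matrix.mul_assoc, hPP, Matrix.one_mul] at this
    simpa only [transpose_mul, transpose_transpose, ← Matrix.mul_assoc] using this.symm
  · rw [← reduce_mul, ← reduce_one, ← reduce_four_two_nsmul_iff, reduce_mul, ht, hs', reduce_one]
    have := congrArg (Pᵀ * · * P) c₃
    simp only [Matrix.mul_smul, Matrix.smul_mul, Matrix.mul_assoc, hPP, Matrix.mul_one] at this
    simp only [← Matrix.mul_assoc, hPP, Matrix.one_mul] at this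
    simpa only [← Matrix.mul_assoc] using this
  · rw [reduce_add, reduce_nsmul, reduce_mul, reduce_mul, ht, reduce_transpose]
    simpa only [Matrix.mul_assoc] using c₄

end ModFour

/-! ### Double cosets and gluing -/

section Criterion

variable {n : ℕ}

theorem reduce_eq_of_dvd {l m : Type*} {q r : ℕ} (hrq : r ∣ q) {A B : Matrix l m ℤ}
    (h : reduce q A = reduce q B) : reduce r A = reduce r B := by
  rw [reduce_eq_reduce_iff] at h ⊢
  exact fun i j => (h i j).of_dvd (Int.natCast_dvd_natCast.2 hrq)

/-- Membership in a left coset of `Γ₀(m)` is a bilinear condition on the first block columns. -/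
theorem inv_mul_mem_gamma0_iff {m : ℕ} (γ γ' : Sp n) : γ⁻¹ * γ' ∈ gamma0 n m ↔
    reduce m (γ.val.toBlocks₁₁ᵀ * γ'.val.toBlocks₂₁) =
      reduce m (γ.val.toBlocks₂₁ᵀ * γ'.val.toBlocks₁₁) := by
  have h : (γ⁻¹ * γ' : Sp n).val.toBlocks₂₁ =
      γ.val.toBlocks₁₁ᵀ * γ'.val.toBlocks₂₁ - γ.val.toBlocks₂₁ᵀ * γ'.val.toBlocks₁₁ := by
    rw [Submonoid.coe_mul, SymplecticGroup.coe_inv]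
    conv_lhs => rw [← fromBlocks_toBlocks γ.val, ← fromBlocks_toBlocks γ'.val]
    rw [fromBlocks_transpose, J]
    simp [fromBlocks_multiply, fromBlocks_neg]
    abel
  change (∀ i j, (m : ℤ) ∣ (γ⁻¹ * γ' : Sp n).val.toBlocks₂₁ i j) ↔ _
  rw [h, reduce_eq_reduce_iff]
  refine forall₂_congr fun i j => ?_
  rw [Matrix.sub_apply, Int.modEq_comm, Int.modEq_iff_dvd]

/-- When a symplectic matrix with first block column `(A; C)` lies in the double coset of the lower
unipotent matrix attached to `M`. -/
theorem mk_eq_mk_lowerUnipotent_iff {m : ℕ} (γ : Sp n) (M : Matrix (Fin n) (Fin n) ℤ)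
    (hM : M.IsSymm) :
    DoubleCoset.mk (gammaInf n) (gamma0 n m) γ =
      DoubleCoset.mk (gammaInf n) (gamma0 n m) (lowerUnipotent M hM) ↔
    ∃ (G : GL (Fin n) ℤ) (Y : Matrix (Fin n) (Fin n) ℤ), Y.IsSymm ∧
      reduce m (G.valᵀ * M * G.val * (γ.val.toBlocks₁₁ + Y * γ.val.toBlocks₂₁)) =
        reduce m γ.val.toBlocks₂₁ := by
  have key (h : Sp n) (G : GL (Fin n) ℤ) (Y : Matrix (Fin n) (Fin n) ℤ)
      (hh : h.val = fromBlocks G.val (G.val * Y) 0 ((G⁻¹ : GL (Fin n) ℤ).val)ᵀ) :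
      (h * γ)⁻¹ * lowerUnipotent M hM ∈ gamma0 n m ↔
      reduce m (G.valᵀ * M * G.val * (γ.val.toBlocks₁₁ + Y * γ.val.toBlocks₂₁)) =
        reduce m γ.val.toBlocks₂₁ := by
    have hG : (G⁻¹).val * G.val = 1 := G.inv_mul
    have hG' : G.valᵀ * (G⁻¹).valᵀ = 1 := by rw [← transpose_mul, hG, transpose_one]
    have e : (h * γ).val = fromBlocks
        (G.val * (γ.val.toBlocks₁₁ + Y * γ.val.toBlocks₂₁))
        (G.val * γ.val.toBlocks₁₂ + G.val * Y * γ.val.toBlocks₂₂)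
        ((G⁻¹).valᵀ * γ.val.toBlocks₂₁) ((G⁻¹).valᵀ * γ.val.toBlocks₂₂) := by
      rw [Submonoid.coe_mul, hh]
      conv_lhs => rw [← fromBlocks_toBlocks γ.val]
      rw [fromBlocks_multiply]
      simp [Matrix.mul_add, Matrix.mul_assoc]
    rw [inv_mul_mem_gamma0_iff, e]
    simp only [toBlocks_fromBlocks₁₁, toBlocks_fromBlocks₂₁, lowerUnipotent, Matrix.mul_one]
    set X := γ.val.toBlocks₁₁ + Y * γ.val.toBlocks₂₁
    set C := γ.val.toBlocks₂₁
    constructor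
    · intro hX
      have := congrArg (fun Z => reduce m G.valᵀ * Zᵀ) hX
      simp only [← reduce_transpose, ← reduce_mul] at this
      simp only [transpose_mul, transpose_transpose, hM.eq] at this
      rw [← Matrix.mul_assoc (G.val)ᵀ (G⁻¹.val)ᵀ, hG', Matrix.one_mul] at this
      simpa only [Matrix.mul_assoc] using this
    · intro hX
      have hG'' : (G⁻¹).valᵀ * G.valᵀ = 1 := by
        rw [← transpose_mul, (G.mul_inv : G.val * (G⁻¹).val = 1), transpose_one]
      have := congrArg (fun Z => (reduce m (G⁻¹).valᵀ * Z)ᵀ) hX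
      simp only [← reduce_mul, ← reduce_transpose] at this
      simp only [← Matrix.mul_assoc, hG'', Matrix.one_mul] at this
      simpa only [transpose_mul, hM.eq, Matrix.mul_assoc] using this
  rw [DoubleCoset.eq]
  constructor
  · rintro ⟨h, ⟨G, Y, hY, hh⟩, k, hk, e⟩
    refine ⟨G, Y, hY, (key h G Y hh).1 ?_⟩
    rwa [e, inv_mul_cancel_left]
  · rintro ⟨G, Y, hY, e⟩
    let h : Sp n := ⟨fromBlocks G.val (G.val * Y) 0 ((G⁻¹ : GL (Fin n) ℤ).val)ᵀ, by
      rw [mem_sp_iff]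
      simp [transpose_mul, hY.eq, Matrix.mul_assoc]⟩
    exact ⟨h, ⟨G, Y, hY, rfl⟩, (h * γ)⁻¹ * lowerUnipotent M hM, (key h G Y rfl).2 e, by group⟩

end Criterion

section Existence

variable {n N : ℕ}

theorem coprime_parts (hsq : Squarefree N) (σ : AdmissibleType n N) {s t : Fin (n + 1)}
    (hst : s ≠ t) : (σ.parts s).Coprime (σ.parts t) := by
  have h₁ := Finset.mul_prod_erase Finset.univ σ.parts (Finset.mem_univ s)
  rw [σ.prod_parts] at h₁
  have h₂ : σ.parts t ∣ ∏ x ∈ Finset.univ.erase s, σ.parts x :=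
    Finset.dvd_prod_of_mem _ (Finset.mem_erase.2 ⟨hst.symm, Finset.mem_univ t⟩)
  rw [← h₁] at hsq
  exact (Nat.coprime_of_squarefree_mul hsq).coprime_dvd_right h₂

theorem parts_dvd (σ : AdmissibleType n N) (s : Fin (n + 1)) : σ.parts s ∣ N :=
  (Finset.dvd_prod_of_mem σ.parts (Finset.mem_univ s)).trans σ.prod_parts.dvd

theorem coprime_four (hodd : Odd N) : (4 : ℕ).Coprime N :=
  (Nat.Coprime.pow_left 2 (Nat.coprime_two_left.2 hodd) :)

theorem transpose_middleForm (k : ℕ) (ε : Sign) : (middleForm k ε)ᵀ = middleForm k ε := by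
  cases ε
  · exact transpose_one
  · ext i j
    simp [middleForm, hyperbolicForm, eq_comm]

theorem isSymm_formMod4 (d k : ℕ) (ε : Sign) : (formMod4 n d k ε).IsSymm := by
  rw [Matrix.IsSymm, formMod4_eq, transpose_add, transpose_smul, transpose_mul, transpose_mul,
    transpose_transpose, transpose_middleForm, idPerpZero, diagonal_transpose, Matrix.mul_assoc]

theorem exists_isOfType (hodd : Odd N) (hsq : Squarefree N) (σ : AdmissibleType n N) :
    ∃ M : Matrix (Fin n) (Fin n) ℤ, IsOfType σ M := by
  obtain ⟨M, hM, h⟩ := exists_isSymm_lift (n := n) (Finset.univ : Finset (Option (Fin (n + 1))))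
    (fun i => i.elim 4 σ.parts) (by
      rintro (_ | s) - (_ | t) - hst
      · exact absurd rfl hst
      · exact (coprime_four hodd).coprime_dvd_right (parts_dvd σ t)
      · exact ((coprime_four hodd).coprime_dvd_right (parts_dvd σ s)).symm
      · exact coprime_parts hsq σ fun h => hst (congrArg some h))
    (fun i => reduce _ (i.elim (formMod4 n σ.d σ.d' σ.ε) fun s => idPerpZero n s)) (by
      rintro (_ | s) -
      · exact (reduce_transpose _).symm.trans (congrArg _ (isSymm_formMod4 _ _ _))
      · exact (reduce_transpose _).symm.trans (congrArg _ (diagonal_transpose _)))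
  exact ⟨M, hM, fun s => reduce_eq_reduce_iff.1 (h (some s) (Finset.mem_univ _)),
    reduce_eq_reduce_iff.1 (h none (Finset.mem_univ _))⟩

end Existence

section Surjectivity

variable {n N : ℕ}

theorem symplectic_relations (γ : Sp n) :
    γ.val.toBlocks₁₁ᵀ * γ.val.toBlocks₂₁ = γ.val.toBlocks₂₁ᵀ * γ.val.toBlocks₁₁ ∧
    γ.val.toBlocks₂₁ * γ.val.toBlocks₂₂ᵀ = γ.val.toBlocks₂₂ * γ.val.toBlocks₂₁ᵀ ∧
    γ.val.toBlocks₁₁ * γ.val.toBlocks₂₂ᵀ - γ.val.toBlocks₁₂ * γ.val.toBlocks₂₁ᵀ = 1 := by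
  have h := γ.2
  rw [← fromBlocks_toBlocks γ.val] at h
  exact ⟨(SymplecticGroup.fromBlocks_mem_iff.1 h).1, ((mem_sp_iff _ _ _ _).1 h).2⟩

/-- Every double coset contains a lower unipotent matrix of some type: the type is read off from
the Smith forms modulo `4` and modulo the primes dividing `N`, and the local solutions are glued by
the Chinese remainder theorem. -/
theorem exists_mk_lowerUnipotent_eq (hodd : Odd N) (hsq : Squarefree N)
    (M : AdmissibleType n N → Matrix (Fin n) (Fin n) ℤ) (hM : ∀ σ, IsOfType σ (M σ)) (γ : Sp n) :
    ∃ σ, DoubleCoset.mk (gammaInf n) (gamma0 n (4 * N)) γ =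
      DoubleCoset.mk (gammaInf n) (gamma0 n (4 * N)) (lowerUnipotent (M σ) (hM σ).isSymm) := by
  obtain ⟨hAC, hCL, hABCL⟩ := symplectic_relations γ
  have hAC' (q : ℕ) : (reduce q γ.val.toBlocks₁₁)ᵀ * reduce q γ.val.toBlocks₂₁ =
      (reduce q γ.val.toBlocks₂₁)ᵀ * reduce q γ.val.toBlocks₁₁ := by
    rw [← reduce_transpose, ← reduce_transpose, ← reduce_mul, ← reduce_mul, hAC]
  obtain ⟨d, d', ε, hd, hε, h4⟩ := exists_isCarriedTo_formMod4 (reduce 4 γ.val.toBlocks₁₁)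
    (reduce 4 γ.val.toBlocks₁₂) (reduce 4 γ.val.toBlocks₂₁) (reduce 4 γ.val.toBlocks₂₂) (hAC' 4)
    (by rw [← reduce_transpose, ← reduce_transpose, ← reduce_mul, ← reduce_mul, hCL])
    (by rw [← reduce_transpose, ← reduce_transpose, ← reduce_mul, ← reduce_mul, ← reduce_sub,
          hABCL, reduce_one])
  have hp (p : ℕ) : ∃ s : Fin (n + 1), p ∈ N.primeFactors →
      IsCarriedTo (reduce p γ.val.toBlocks₁₁) (reduce p γ.val.toBlocks₂₁)
        (reduce p (idPerpZero n s)) := by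
    by_cases hpN : p ∈ N.primeFactors
    · have : Fact p.Prime := ⟨Nat.prime_of_mem_primeFactors hpN⟩
      obtain ⟨s, hs, h⟩ := exists_isCarriedTo_idPerpZero _ _ (hAC' p)
      exact ⟨⟨s, by omega⟩, fun _ => h⟩
    · exact ⟨0, fun h => absurd h hpN⟩
  choose s hs using hp
  let σ : AdmissibleType n N :=
    { parts := fun t => ∏ p ∈ N.primeFactors with s p = t, p
      prod_parts := by
        rw [Finset.prod_fiberwise, Nat.prod_primeFactors_of_squarefree hsq]
      d := d
      d' := d'
      d_add_d'_le := hd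
      ε := ε
      even_of_minus := hε }
  refine ⟨σ, (mk_eq_mk_lowerUnipotent_iff γ _ _).2 ?_⟩
  set Q : Finset ℕ := insert 4 N.primeFactors with hQ
  have h4Q (p : ℕ) (h : p ∈ N.primeFactors) : (4 : ℕ).Coprime p :=
    (coprime_four hodd).coprime_dvd_right (Nat.dvd_of_mem_primeFactors h)
  have hQc : (Q : Set ℕ).Pairwise Nat.Coprime := by
    rw [hQ, Finset.coe_insert, Set.pairwise_insert]
    exact ⟨fun p hp q hq hpq => (Nat.coprime_primes (Nat.prime_of_mem_primeFactors hp)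
      (Nat.prime_of_mem_primeFactors hq)).2 hpq,
      fun p hp _ => ⟨h4Q p hp, (h4Q p hp).symm⟩⟩
  have hc (q : ℕ) : ∃ (G : Matrix.SpecialLinearGroup (Fin n) (ZMod q))
      (Y : Matrix (Fin n) (Fin n) (ZMod q)), q ∈ Q → G ∈ elementaryGroup n (ZMod q) ∧ Y.IsSymm ∧
      (G : Matrix (Fin n) (Fin n) (ZMod q))ᵀ * reduce q (M σ) *
        (G : Matrix (Fin n) (Fin n) (ZMod q)) *
        (reduce q γ.val.toBlocks₁₁ + Y * reduce q γ.val.toBlocks₂₁) =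
        reduce q γ.val.toBlocks₂₁ := by
    by_cases hq : q ∈ Q
    · obtain ⟨G, hG, Y, hY, e⟩ : IsCarriedTo (reduce q γ.val.toBlocks₁₁)
          (reduce q γ.val.toBlocks₂₁) (reduce q (M σ)) := by
        rcases Finset.mem_insert.1 hq with rfl | hq
        · rwa [reduce_eq_reduce_iff.2 (hM σ).modEq_four]
        · have hd : q ∣ σ.parts (s q) :=
            Finset.dvd_prod_of_mem (fun p => p) (s := {p ∈ N.primeFactors | s p = s q})
              (Finset.mem_filter.2 ⟨hq, rfl⟩)
          rw [reduce_eq_of_dvd hd (reduce_eq_reduce_iff.2 ((hM σ).modEq_parts (s q)))]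
          exact hs q hq
      exact ⟨G, Y, fun _ => ⟨hG, hY, e⟩⟩
    · exact ⟨1, 0, fun h => absurd h hq⟩
  choose G Y hGY using hc
  obtain ⟨g, hg⟩ := exists_simultaneous_lift Q hQc G fun q hq => (hGY q hq).1
  obtain ⟨y, hy, hyY⟩ := exists_isSymm_lift Q id hQc Y fun q hq => (hGY q hq).2.1
  refine ⟨Matrix.SpecialLinearGroup.toGL g, y, hy, ?_⟩
  change reduce (4 * N) ((g : Matrix (Fin n) (Fin n) ℤ)ᵀ * M σ * (g : Matrix (Fin n) (Fin n) ℤ) *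
    (γ.val.toBlocks₁₁ + y * γ.val.toBlocks₂₁)) = _
  have hq (q : ℕ) (hq : q ∈ Q) : reduce q ((g : Matrix (Fin n) (Fin n) ℤ)ᵀ * M σ *
      (g : Matrix (Fin n) (Fin n) ℤ) * (γ.val.toBlocks₁₁ + y * γ.val.toBlocks₂₁)) =
      reduce q γ.val.toBlocks₂₁ := by
    have h₁ : reduce q (g : Matrix (Fin n) (Fin n) ℤ) = G q := congrArg Subtype.val (hg q hq)
    have h₂ : reduce q y = Y q := hyY q hq
    rw [reduce_mul, reduce_mul, reduce_mul, reduce_add, reduce_mul, reduce_transpose, h₁, h₂]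
    exact (hGY q hq).2.2
  have hprod : 4 * N = ∏ q ∈ Q, q := by
    rw [hQ, Finset.prod_insert, Nat.prod_primeFactors_of_squarefree hsq]
    exact fun h => by simpa using h4Q 4 h
  rw [reduce_eq_reduce_iff]
  intro i j
  rw [Int.modEq_iff_dvd, hprod, Nat.cast_prod]
  exact Finset.prod_dvd_of_coprime (fun p hp q hq hpq => Nat.isCoprime_iff_coprime.2
    (hQc hp hq hpq)) fun q hq' => (Int.modEq_iff_dvd).1 (reduce_eq_reduce_iff.1 (hq q hq') i j)

end Surjectivity

/-! ### Invariants of a double coset -/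

section Injectivity

variable {n N : ℕ}

theorem card_filter_val_lt {s : ℕ} (hs : s ≤ n) :
    (Finset.univ.filter fun i : Fin n => (i : ℕ) < s).card = s := by
  rw [Fin.card_filter_val_lt, min_eq_right hs]

theorem rank_reduce_idPerpZero {p s : ℕ} [Fact p.Prime] (hs : s ≤ n) :
    (reduce p (idPerpZero n s)).rank = s := by
  rw [idPerpZero, reduce_diagonal, rank_diagonal, Fintype.card_subtype]
  conv_rhs => rw [← card_filter_val_lt hs]
  congr 1
  ext i
  by_cases h : (i : ℕ) < s <;> simp [h]

/-- A congruence between the matrices representing two cusps is a factorization of one through the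
other, so it bounds ranks. -/
theorem rank_reduce_le {m p : ℕ} [Fact p.Prime] (hp : p ∣ m)
    {G Y M M' : Matrix (Fin n) (Fin n) ℤ}
    (h : reduce m (Gᵀ * M' * G * (1 + Y * M)) = reduce m M) :
    (reduce p M).rank ≤ (reduce p M').rank := by
  rw [← reduce_eq_of_dvd hp h, Matrix.mul_assoc, reduce_mul, reduce_mul]
  exact (rank_mul_le_left _ _).trans (rank_mul_le_right _ _)

/-- The number of vectors modulo `4` in the image of an integral matrix. -/
noncomputable def imageCard (M : Matrix (Fin n) (Fin n) ℤ) : ℕ :=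
  (Set.range fun v : Fin n → ZMod 4 => reduce 4 M *ᵥ v).ncard

theorem imageCard_le_of_eq_mul {M M' : Matrix (Fin n) (Fin n) ℤ}
    {X Z : Matrix (Fin n) (Fin n) ℤ} (h : reduce 4 M = reduce 4 (X * M' * Z)) :
    imageCard M ≤ imageCard M' := by
  have hsub : (Set.range fun v : Fin n → ZMod 4 => reduce 4 M *ᵥ v) ⊆
      (fun w => reduce 4 X *ᵥ w) '' Set.range fun v : Fin n → ZMod 4 => reduce 4 M' *ᵥ v := by
    rintro _ ⟨v, rfl⟩
    refine ⟨_, ⟨reduce 4 Z *ᵥ v, rfl⟩, ?_⟩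
    simp only [h, reduce_mul, mulVec_mulVec, Matrix.mul_assoc]
  exact (Set.ncard_le_ncard hsub (Set.toFinite _)).trans (Set.ncard_image_le (Set.toFinite _))

theorem imageCard_plusForm {d k : ℕ} (h : d + k ≤ n) :
    imageCard (plusForm n d k) = 2 ^ d * 2 ^ (d + k) := by
  classical
  let c (i : Fin n) : ZMod 4 := if (i : ℕ) < d then 1 else if (i : ℕ) < d + k then 2 else 0
  have hr : (Set.range fun v : Fin n → ZMod 4 => reduce 4 (plusForm n d k) *ᵥ v) =
      (Fintype.piFinset fun i => Finset.univ.image fun x => c i * x : Finset (Fin n → ZMod 4)) := by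
    ext w
    simp only [Set.mem_range, Finset.mem_coe, Fintype.mem_piFinset, Finset.mem_image,
      Finset.mem_univ, true_and]
    have hmul (v : Fin n → ZMod 4) (i) : (reduce 4 (plusForm n d k) *ᵥ v) i = c i * v i := by
      rw [plusForm, reduce_diagonal, mulVec_diagonal]
      simp only [c]
      split_ifs <;> simp
    constructor
    · rintro ⟨v, rfl⟩ i
      exact ⟨v i, (hmul v i).symm⟩
    · intro hw
      choose v hv using hw
      exact ⟨v, funext fun i => (hmul v i).trans (hv i)⟩
  have hcard (i : Fin n) : (Finset.univ.image fun x => c i * x).card =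
      (if (i : ℕ) < d then 2 else 1) * (if (i : ℕ) < d + k then 2 else 1) := by
    have h1 : (Finset.univ.image fun x : ZMod 4 => 1 * x).card = 4 := by decide
    have h2 : (Finset.univ.image fun x : ZMod 4 => 2 * x).card = 2 := by decide
    have h0 : (Finset.univ.image fun x : ZMod 4 => 0 * x).card = 1 := by decide
    simp only [c]
    split_ifs <;> omega
  rw [imageCard, hr, Set.ncard_coe_finset, Fintype.card_piFinset, Finset.prod_congr rfl
    fun i _ => hcard i, Finset.prod_mul_distrib, Finset.prod_ite, Finset.prod_ite]
  simp only [Finset.prod_const, one_pow, mul_one]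
  rw [card_filter_val_lt h, card_filter_val_lt (by omega)]

theorem middleForm_mul_self {k : ℕ} {ε : Sign} (hε : ε = Sign.minus → Even k ∧ k ≠ 0) :
    middleForm k ε * middleForm k ε = 1 := by
  cases ε
  · exact Matrix.one_mul 1
  · exact hyperbolicForm_mul_self (hε rfl).1

theorem imageCard_formMod4 {d k : ℕ} (h : d + k ≤ n) {ε : Sign}
    (hε : ε = Sign.minus → Even k ∧ k ≠ 0) :
    imageCard (formMod4 n d k ε) = 2 ^ d * 2 ^ (d + k) := by
  rw [← imageCard_plusForm h]
  have hP := transpose_blockInclusion_mul_self h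
  have hDP := idPerpZero_mul_blockInclusion (n := n) (d := d) (k := k)
  -- Both forms are obtained from each other by a column operation in the middle block.
  have key (X Z : Matrix (Fin k) (Fin k) ℤ) :
      (idPerpZero n d + 2 • (blockInclusion n d k * X * (blockInclusion n d k)ᵀ)) *
        (1 + blockInclusion n d k * (Z - 1) * (blockInclusion n d k)ᵀ) =
      idPerpZero n d + 2 • (blockInclusion n d k * (X * Z) * (blockInclusion n d k)ᵀ) := by
    set P := blockInclusion n d k
    set D := idPerpZero n d
    calc _ = D + (D * P) * ((Z - 1) * Pᵀ) + 2 • (P * X * Pᵀ) +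
          2 • (P * X * ((Pᵀ * P) * ((Z - 1) * Pᵀ))) := by
          simp only [Matrix.mul_add, Matrix.add_mul, Matrix.mul_one, Matrix.mul_assoc,
            Matrix.smul_mul]
          abel
      _ = _ := by
          rw [hDP, hP, Matrix.zero_mul, Matrix.one_mul, Matrix.sub_mul, Matrix.mul_sub,
            Matrix.one_mul, smul_sub]
          simp only [Matrix.mul_assoc]
          abel
  have e₁ := key (middleForm k ε) (middleForm k ε)
  have e₂ := key 1 (middleForm k ε)
  rw [middleForm_mul_self hε, ← formMod4_eq, ← plusForm_eq] at e₁
  rw [Matrix.one_mul, ← formMod4_eq, ← plusForm_eq] at e₂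
  exact le_antisymm
    (imageCard_le_of_eq_mul (X := 1) (congrArg _ (by rw [Matrix.one_mul]; exact e₂.symm)))
    (imageCard_le_of_eq_mul (X := 1) (congrArg _ (by rw [Matrix.one_mul]; exact e₁.symm)))

/-- The quadratic form of `M` is divisible by `4` on all vectors `v` with `M v` even. This
distinguishes the two signs. -/
def IsEvenOnKernel (M : Matrix (Fin n) (Fin n) ℤ) : Prop :=
  ∀ v y : Fin n → ℤ, M *ᵥ v = 2 • y → (4 : ℤ) ∣ v ⬝ᵥ M *ᵥ v

theorem exists_eq_add_four_nsmul {A B : Matrix (Fin n) (Fin n) ℤ} (h : reduce 4 A = reduce 4 B) :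
    ∃ Z : Matrix (Fin n) (Fin n) ℤ, A = B + 4 • Z := by
  rw [reduce_eq_reduce_iff] at h
  choose Z hZ using fun i j => (Int.modEq_iff_dvd.1 (h i j).symm)
  refine ⟨Matrix.of Z, ?_⟩
  ext i j
  have := hZ i j
  rw [Matrix.add_apply, Matrix.smul_apply, of_apply, nsmul_eq_mul]
  push_cast at this ⊢
  omega

/-- The vector `w = G (1 + Y M) v` satisfies `Gᵀ M' w ≡ M v` modulo `4`, hence it lies in the kernel
of `M'` modulo `2` when `v` lies in that of `M`, and there `w ⬝ M' w ≡ v ⬝ M v` modulo `4`. -/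
theorem IsEvenOnKernel.of_reduce_eq {M M' : Matrix (Fin n) (Fin n) ℤ}
    {G : GL (Fin n) ℤ} {Y : Matrix (Fin n) (Fin n) ℤ}
    (h : reduce 4 (G.valᵀ * M' * G.val * (1 + Y * M)) = reduce 4 M)
    (hM' : IsEvenOnKernel M') : IsEvenOnKernel M := by
  intro v y hv
  obtain ⟨Z, hZ⟩ := exists_eq_add_four_nsmul h
  have hG' : (G⁻¹).valᵀ * G.valᵀ = 1 := by
    rw [← transpose_mul, (G.mul_inv : G.val * (G⁻¹).val = 1), transpose_one]
  set w := (G.val * (1 + Y * M)) *ᵥ v with hw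
  have hGw : G.valᵀ *ᵥ (M' *ᵥ w) = M *ᵥ v + 4 • (Z *ᵥ v) := by
    rw [hw, mulVec_mulVec, mulVec_mulVec, ← smul_mulVec, ← add_mulVec, ← hZ]
    simp only [Matrix.mul_assoc]
  have h₁ : M' *ᵥ w = 2 • ((G⁻¹).valᵀ *ᵥ (y + 2 • (Z *ᵥ v))) := by
    have : M' *ᵥ w = (G⁻¹).valᵀ *ᵥ (G.valᵀ *ᵥ (M' *ᵥ w)) := by
      rw [mulVec_mulVec _ (G⁻¹).valᵀ, hG', one_mulVec]
    have e : 2 • y + 4 • (Z *ᵥ v) = 2 • (y + 2 • (Z *ᵥ v)) := by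
      rw [smul_add, smul_smul]
      norm_num
    rw [this, hGw, hv, e, mulVec_smul]
  have h₂ := hM' w _ h₁
  have h₃ : w ⬝ᵥ M' *ᵥ w = (v + Y *ᵥ (M *ᵥ v)) ⬝ᵥ (M *ᵥ v + 4 • (Z *ᵥ v)) := by
    have e : w = G.val *ᵥ (v + Y *ᵥ (M *ᵥ v)) := by
      rw [hw, ← mulVec_mulVec, add_mulVec, one_mulVec, mulVec_mulVec _ Y M]
    rw [← hGw]
    conv_lhs => rw [e]
    rw [dotProduct_mulVec _ G.valᵀ, vecMul_transpose, ← e]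
  rw [h₃, dotProduct_add, dotProduct_smul, add_dotProduct] at h₂
  have h₄ : (Y *ᵥ (M *ᵥ v)) ⬝ᵥ M *ᵥ v = 4 * ((Y *ᵥ y) ⬝ᵥ y) := by
    rw [hv, mulVec_smul, smul_dotProduct, dotProduct_smul, smul_smul, nsmul_eq_mul]
    norm_num
  rw [h₄] at h₂
  simp only [nsmul_eq_mul] at h₂
  push_cast at h₂
  omega

theorem two_dvd_dotProduct_mulVec {k : ℕ} {H : Matrix (Fin k) (Fin k) ℤ} (hs : H.IsSymm)
    (h0 : ∀ i, H i i = 0) (u : Fin k → ℤ) : (2 : ℤ) ∣ u ⬝ᵥ H *ᵥ u := by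
  refine (ZMod.intCast_zmod_eq_zero_iff_dvd _ 2).1 ?_
  have h : u ⬝ᵥ H *ᵥ u = ∑ p : Fin k × Fin k, u p.1 * (H p.1 p.2 * u p.2) := by
    rw [Fintype.sum_prod_type]
    simp only [dotProduct, mulVec, Finset.mul_sum]
  rw [h, Int.cast_sum]
  -- The terms for `(i, j)` and `(j, i)` cancel modulo `2`.
  refine Finset.sum_involution (fun p _ => p.swap) (fun p _ => ?_) (fun p _ hp hp' => ?_)
    (fun p _ => Finset.mem_univ _) (fun p _ => Prod.swap_swap p)
  · have : u p.2 * (H p.2 p.1 * u p.1) = u p.1 * (H p.1 p.2 * u p.2) := by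
      rw [hs.apply]
      ring
    rw [Prod.fst_swap, Prod.snd_swap, this]
    exact CharTwo.add_self_eq_zero _
  · have : p.2 = p.1 := congrArg Prod.fst hp'
    rw [this, h0] at hp
    simp at hp

/-- If `D v + 2 P H Pᵀ v` is even then `D v` is even, so `v ⬝ D v = D v ⬝ D v` is divisible by `4`;
the other part of the form takes values in `4ℤ` as `H` has zero diagonal. -/
theorem isEvenOnKernel_minus (d k : ℕ) : IsEvenOnKernel (formMod4 n d k Sign.minus) := by
  intro v y hv
  rw [formMod4_eq] at hv ⊢
  set P := blockInclusion n d k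
  have hD : (idPerpZero n d)ᵀ = idPerpZero n d := diagonal_transpose _
  have hDD := idPerpZero_mul_self (n := n) d
  set D := idPerpZero n d
  obtain ⟨z, hz⟩ : ∃ z, D *ᵥ v = 2 • z := by
    refine ⟨y - (P * middleForm k Sign.minus * Pᵀ) *ᵥ v, ?_⟩
    rw [smul_sub, ← hv, ← smul_mulVec, ← sub_mulVec, add_sub_cancel_right]
  have h₁ : v ⬝ᵥ D *ᵥ v = 4 * (z ⬝ᵥ z) := by
    have : v ⬝ᵥ D *ᵥ v = (D *ᵥ v) ⬝ᵥ (D *ᵥ v) := by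
      conv_lhs => rw [← hDD, ← mulVec_mulVec, dotProduct_mulVec, ← mulVec_transpose, hD]
    rw [this, hz, smul_dotProduct, dotProduct_smul, smul_smul, nsmul_eq_mul]
    norm_num
  have h₂ : v ⬝ᵥ (P * middleForm k Sign.minus * Pᵀ) *ᵥ v =
      (Pᵀ *ᵥ v) ⬝ᵥ middleForm k Sign.minus *ᵥ (Pᵀ *ᵥ v) := by
    rw [← mulVec_mulVec, ← mulVec_mulVec, dotProduct_mulVec, ← mulVec_transpose]
  have h₃ := two_dvd_dotProduct_mulVec (transpose_middleForm k Sign.minus)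
    (by simp [middleForm, hyperbolicForm]) (Pᵀ *ᵥ v)
  rw [add_mulVec, dotProduct_add, smul_mulVec, dotProduct_smul, h₁, h₂, nsmul_eq_mul]
  push_cast
  omega

theorem not_isEvenOnKernel_plus {d k : ℕ} (h : d + k ≤ n) (hk : k ≠ 0) :
    ¬ IsEvenOnKernel (formMod4 n d k Sign.plus) := by
  intro he
  have hd : d < n := by omega
  have hv : plusForm n d k *ᵥ Pi.single ⟨d, hd⟩ 1 = 2 • Pi.single ⟨d, hd⟩ 1 := by
    ext i
    rw [plusForm, mulVec_diagonal, Pi.smul_apply]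
    by_cases hi : i = ⟨d, hd⟩
    · subst hi
      simp [Nat.pos_of_ne_zero hk]
    · simp [hi]
  have := he _ _ hv
  rw [formMod4, hv, dotProduct_smul] at this
  simp at this

theorem exists_reduce_eq_of_mk_eq {m : ℕ} {M M' : Matrix (Fin n) (Fin n) ℤ} {hM : M.IsSymm}
    {hM' : M'.IsSymm} (h : DoubleCoset.mk (gammaInf n) (gamma0 n m) (lowerUnipotent M hM) =
      DoubleCoset.mk (gammaInf n) (gamma0 n m) (lowerUnipotent M' hM')) :
    ∃ (G : GL (Fin n) ℤ) (Y : Matrix (Fin n) (Fin n) ℤ),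
      reduce m (G.valᵀ * M' * G.val * (1 + Y * M)) = reduce m M := by
  obtain ⟨G, Y, -, e⟩ := (mk_eq_mk_lowerUnipotent_iff _ _ _).1 h
  exact ⟨G, Y, e⟩

/-- The invariants of the double coset, as inequalities; the situation being symmetric, they are
all equalities. -/
theorem invariants_le {σ σ' : AdmissibleType n N} {M M' : Matrix (Fin n) (Fin n) ℤ}
    (hM : IsOfType σ M) (hM' : IsOfType σ' M')
    (h : DoubleCoset.mk (gammaInf n) (gamma0 n (4 * N)) (lowerUnipotent M hM.isSymm) =
      DoubleCoset.mk (gammaInf n) (gamma0 n (4 * N)) (lowerUnipotent M' hM'.isSymm)) :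
    (∀ (p : ℕ) (s s' : Fin (n + 1)), p.Prime → p ∣ σ.parts s → p ∣ σ'.parts s' → s ≤ s') ∧
    σ.d ≤ σ'.d ∧ 2 ^ σ.d * 2 ^ (σ.d + σ.d') ≤ 2 ^ σ'.d * 2 ^ (σ'.d + σ'.d') ∧
    (IsEvenOnKernel (formMod4 n σ'.d σ'.d' σ'.ε) → IsEvenOnKernel (formMod4 n σ.d σ.d' σ.ε)) := by
  obtain ⟨G, Y, e⟩ := exists_reduce_eq_of_mk_eq h
  have e4 := reduce_eq_of_dvd (Dvd.intro N rfl) e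
  have hM4 : reduce 4 M = reduce 4 (formMod4 n σ.d σ.d' σ.ε) :=
    reduce_eq_reduce_iff.2 hM.modEq_four
  have hM4' : reduce 4 M' = reduce 4 (formMod4 n σ'.d σ'.d' σ'.ε) :=
    reduce_eq_reduce_iff.2 hM'.modEq_four
  have hF : reduce 4 (G.valᵀ * formMod4 n σ'.d σ'.d' σ'.ε * G.val *
      (1 + Y * formMod4 n σ.d σ.d' σ.ε)) = reduce 4 (formMod4 n σ.d σ.d' σ.ε) := by
    simp only [reduce_mul, reduce_add] at e4 ⊢
    rwa [← hM4, ← hM4']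
  refine ⟨fun p s s' hp hs hs' => ?_, ?_, ?_, fun he => he.of_reduce_eq hF⟩
  · have : Fact p.Prime := ⟨hp⟩
    have hle := rank_reduce_le (((hs.trans (parts_dvd σ s)).trans (Dvd.intro_left 4 rfl))) e
    rwa [reduce_eq_of_dvd hs (reduce_eq_reduce_iff.2 (hM.modEq_parts s)),
      reduce_eq_of_dvd hs' (reduce_eq_reduce_iff.2 (hM'.modEq_parts s')),
      rank_reduce_idPerpZero (by omega), rank_reduce_idPerpZero (by omega)] at hle
  · have h2 (d k : ℕ) (ε : Sign) : reduce 2 (formMod4 n d k ε) = reduce 2 (idPerpZero n d) := by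
      rw [formMod4_eq, reduce_add, reduce_nsmul]
      ext i j
      rw [Matrix.add_apply, Matrix.smul_apply, CharTwo.two_nsmul, add_zero]
    have hle := rank_reduce_le (p := 2) (Nat.dvd_of_mod_eq_zero rfl) hF
    rwa [h2, h2, rank_reduce_idPerpZero (by have := σ.d_add_d'_le; omega),
      rank_reduce_idPerpZero (by have := σ'.d_add_d'_le; omega)] at hle
  · rw [← imageCard_formMod4 σ.d_add_d'_le σ.even_of_minus,
      ← imageCard_formMod4 σ'.d_add_d'_le σ'.even_of_minus]
    refine imageCard_le_of_eq_mul (X := G.valᵀ)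
      (Z := G.val * (1 + Y * formMod4 n σ.d σ.d' σ.ε)) ?_
    rw [← hF]
    simp only [Matrix.mul_assoc]

/-- Lower unipotent matrices in the same double coset are of the same type. -/
theorem eq_of_mk_eq (hsq : Squarefree N) {σ σ' : AdmissibleType n N}
    {M M' : Matrix (Fin n) (Fin n) ℤ} (hM : IsOfType σ M) (hM' : IsOfType σ' M')
    (h : DoubleCoset.mk (gammaInf n) (gamma0 n (4 * N)) (lowerUnipotent M hM.isSymm) =
      DoubleCoset.mk (gammaInf n) (gamma0 n (4 * N)) (lowerUnipotent M' hM'.isSymm)) :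
    σ = σ' := by
  obtain ⟨hp, hd, hc, hε⟩ := invariants_le hM hM' h
  obtain ⟨hp', hd', hc', hε'⟩ := invariants_le hM' hM h.symm
  have d_eq : σ.d = σ'.d := le_antisymm hd hd'
  have d'_eq : σ.d' = σ'.d' := by
    have := le_antisymm hc hc'
    rw [← pow_add, ← pow_add] at this
    have := Nat.pow_right_injective le_rfl this
    omega
  have exists_part (τ : AdmissibleType n N) {p : ℕ} (hpp : p.Prime) (hpN : p ∣ N) :
      ∃ s, p ∣ τ.parts s := by
    rw [← τ.prod_parts] at hpN
    obtain ⟨s, -, hs⟩ := (Prime.dvd_finsetProd_iff hpp.prime _).1 hpN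
    exact ⟨s, hs⟩
  have dvd_iff (p : ℕ) (hpp : p.Prime) (s) : p ∣ σ.parts s ↔ p ∣ σ'.parts s := by
    constructor
    · intro hs
      obtain ⟨s', hs'⟩ := exists_part σ' hpp (hs.trans (parts_dvd σ s))
      rwa [le_antisymm (hp p s s' hpp hs hs') (hp' p s' s hpp hs' hs)]
    · intro hs
      obtain ⟨s', hs'⟩ := exists_part σ hpp (hs.trans (parts_dvd σ' s))
      rwa [le_antisymm (hp' p s s' hpp hs hs') (hp p s' s hpp hs' hs)]
  have squarefree_parts (τ : AdmissibleType n N) (s) : Squarefree (τ.parts s) :=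
    hsq.squarefree_of_dvd (parts_dvd τ s)
  have parts_eq : σ.parts = σ'.parts := by
    ext s
    rw [← Nat.prod_primeFactors_of_squarefree (squarefree_parts σ s),
      ← Nat.prod_primeFactors_of_squarefree (squarefree_parts σ' s)]
    congr 1
    ext p
    simp only [Nat.mem_primeFactors, (squarefree_parts _ s).ne_zero, ne_eq, not_false_eq_true,
      and_true]
    exact and_congr_right fun hpp => dvd_iff p hpp s
  have ε_eq : σ.ε = σ'.ε := by
    have hσ := σ.even_of_minus
    have hσ' := σ'.even_of_minus
    have hle := σ.d_add_d'_le
    have hle' := σ'.d_add_d'_le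
    rcases e : σ.ε <;> rcases e' : σ'.ε <;> rw [e, e'] at hε hε'
    · exact absurd (hε (isEvenOnKernel_minus _ _))
        (not_isEvenOnKernel_plus hle (d'_eq ▸ (hσ' e').2))
    · exact absurd (hε' (isEvenOnKernel_minus _ _))
        (not_isEvenOnKernel_plus hle' (d'_eq ▸ (hσ e).2))
  exact AdmissibleType.ext parts_eq d_eq d'_eq ε_eq

end Injectivity

end SiegelCusps

theorem proposition3p4 (n N : ℕ) (hn : 1 ≤ n) (hodd : Odd N) (hsq : Squarefree N) :
    (∀ σ : SiegelCusps.AdmissibleType n N,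
      ∃ M : Matrix (Fin n) (Fin n) ℤ, SiegelCusps.IsOfType σ M) ∧
    ∀ (M : SiegelCusps.AdmissibleType n N → Matrix (Fin n) (Fin n) ℤ)
      (hM : ∀ σ, SiegelCusps.IsOfType σ (M σ)),
      Function.Bijective (fun σ : SiegelCusps.AdmissibleType n N =>
        DoubleCoset.mk (SiegelCusps.gammaInf n) (SiegelCusps.gamma0 n (4 * N))
          (SiegelCusps.lowerUnipotent (M σ) (hM σ).isSymm)) := by
  refine ⟨fun σ => SiegelCusps.exists_isOfType hodd hsq σ, fun M hM => ⟨fun σ σ' h => ?_, fun x => ?_⟩⟩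
  · exact SiegelCusps.eq_of_mk_eq hsq (hM σ) (hM σ') h
  · obtain ⟨γ, rfl⟩ := Quotient.exists_rep x
    obtain ⟨σ, hσ⟩ := SiegelCusps.exists_mk_lowerUnipotent_eq hodd hsq M hM γ
    exact ⟨σ, hσ.symm⟩
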